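/- Let $Q=(Q_0,Q_1)$ be a finite, connected, acyclic quiver (parallel arrows allowed; acyclic means without oriented cycles, so there are no loops) together with a plane embedding: the vertices are distinct points of $\mathbb{R}^2$, every arrow is drawn as a simple arc from its source to its target that is regular and piecewise continuously differentiable (e.g. polygonal or smooth), and an arc meets the vertices and the other arcs only in its end points. The flow polytope is $\operatorname{Fl}_Q=\{r\in V_Q \mid r_a\ge -1 \text{ for all } a\in Q_1\}$, where $V_Q\subset\mathbb{R}^{Q_1}$ is the subspace given by $\sum_{a\to q} r_a=\sum_{b\leftarrow q} r_b$ for every $q\in Q_0$ (the sum over the arrows with target $q$ equals the sum over the arrows with source $q$); $V_Q$ carries the lattice $V_Q\cap\mathbb{Z}^{Q_1}$ and $V_Q^*$ the dual lattice. The set $Q_2$ of bounded regions of $\mathbb{R}^2\setminus Q$ is finite. The dual starred quiver $Q^\vee$ has one normal vertex for each region in $Q_2$ and one starred vertex $\star$ for the unbounded region; each arrow of $Q$ that separates two different regions gives an arrow of $Q^\vee$ that crosses it from left to right (duplicate arrows are identified). Its root polytope $\operatorname{Root}(Q^\vee)\subset\mathbb{R}^{Q_2}$ is the convex hull of the points $e_w-e_v$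 for the arrows $v\to w$ of $Q^\vee$, where $e_\star:=0$. The polar dual of a full-dimensional polytope $P$ with the origin in its interior is $P^*=\{y\mid \langle y,x\rangle\ge -1 \text{ for all }x\in P\}$ in the dual space. Two lattice polytopes are integrally equivalent if an affine map restricts to a bijection between them and to a bijection between the lattice points of their affine spans. A lattice polytope in $\mathbb{R}^n$ with the origin in its interior is reflexive if its polar dual is a lattice polytope, and so is every polytope integrally equivalent to it. Then $\operatorname{Fl}_Q$ is a lattice polytope of full dimension in $V_Q$ with the origin in its interior, and, if $\mathbb{R}^2\setminus Q$ has at least one bounded region, $\operatorname{Root}(Q^\vee)$ is integrally equivalent to the polar dual $\operatorname{Fl}_Q^*\subset V_Q^*$ of $\operatorname{Fl}_Q$. As a corollary, the flow polytope $\operatorname{Fl}_Q$ of every connected plane acyclic quiver $Q$ is reflexive. -/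

import Mathlib

/-! ### Lattice polytopes, integral equivalence, polar duality, reflexivity

A lattice polytope lives in a real vector space `E` that carries a lattice `Λ`. For `ℝⁿ` the lattice
is `ℤⁿ`, for a rational subspace of `ℝⁿ` it is the set of its integer points, and the dual space
carries the dual lattice. -/

/-- The integers inside `ℝ`. -/
def realIntegers : AddSubgroup ℝ := (Int.castAddHom ℝ).range

/-- The lattice `ℤ^ι` inside `ℝ^ι`. -/
def integerLattice (ι : Type*) : AddSubgroup (ι → ℝ) :=
  AddSubgroup.pi Set.univ (fun _ => realIntegers)

/-- The lattice in the dual space formed by the functionals that are integral on `Λ`. -/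
def dualLattice {E : Type*} [AddCommGroup E] [Module ℝ E] (Λ : AddSubgroup E) :
    AddSubgroup (Module.Dual ℝ E) where
  carrier := {φ | ∀ x ∈ Λ, φ x ∈ realIntegers}
  zero_mem' := fun _ _ => realIntegers.zero_mem
  add_mem' := fun hφ hψ x hx => realIntegers.add_mem (hφ x hx) (hψ x hx)
  neg_mem' := fun hφ x hx => realIntegers.neg_mem (hφ x hx)

/-- `P` is a lattice polytope: the convex hull of finitely many lattice points. -/
def IsLatticePolytope {E : Type*} [AddCommGroup E] [Module ℝ E] (Λ : AddSubgroup E)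
    (P : Set E) : Prop :=
  ∃ S : Finset E, (∀ x ∈ S, x ∈ Λ) ∧ P = convexHull ℝ (S : Set E)

/-- Integral equivalence of the lattice polytopes `P` and `P'`: an affine map restricts to a bijection
`P → P'` and to a bijection between the lattice points of their affine spans. -/
def IntegrallyEquivalent {E F : Type*} [AddCommGroup E] [Module ℝ E] [AddCommGroup F] [Module ℝ F]
    (Λ : AddSubgroup E) (P : Set E) (Λ' : AddSubgroup F) (P' : Set F) : Prop :=
  IsLatticePolytope Λ P ∧ IsLatticePolytope Λ' P' ∧
    ∃ φ : E →ᵃ[ℝ] F, Set.BijOn φ P P' ∧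
      Set.BijOn φ ((Λ : Set E) ∩ affineSpan ℝ P) ((Λ' : Set F) ∩ affineSpan ℝ P')

/-- The polar dual `{y | ⟨y, x⟩ ≥ -1 for all x ∈ P}`, a subset of the dual space. -/
def polarDual {E : Type*} [AddCommGroup E] [Module ℝ E] (P : Set E) : Set (Module.Dual ℝ E) :=
  {y | ∀ x ∈ P, -1 ≤ y x}

/-- The polytopes whose polar dual is taken: lattice polytopes of full dimension with the origin in
their interior. -/
def HasOriginInterior {E : Type*} [AddCommGroup E] [Module ℝ E] [TopologicalSpace E]
    (Λ : AddSubgroup E) (P : Set E) : Prop :=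
  IsLatticePolytope Λ P ∧ (0 : E) ∈ interior P

/-- A reflexive polytope in `ℝⁿ`: a lattice polytope of full dimension, with the origin in its
interior, whose polar dual is a lattice polytope as well. -/
def IsReflexiveFullDim {n : ℕ} (P : Set (Fin n → ℝ)) : Prop :=
  HasOriginInterior (integerLattice (Fin n)) P ∧
    IsLatticePolytope (dualLattice (integerLattice (Fin n))) (polarDual P)

/-- A polytope is called reflexive if it is integrally equivalent to a reflexive polytope in
some `ℝⁿ`. -/
def IsReflexivePolytope {E : Type*} [AddCommGroup E] [Module ℝ E] (Λ : AddSubgroup E)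
    (P : Set E) : Prop :=
  ∃ (n : ℕ) (P' : Set (Fin n → ℝ)),
    IsReflexiveFullDim P' ∧ IntegrallyEquivalent Λ P (integerLattice (Fin n)) P'

/-! ### Starred quivers and root polytopes -/

/-- A starred quiver with normal vertices `N` and starred vertices `S`. Its arrows form a set of
ordered pairs of vertices; there are no loops and no arrows between two starred vertices. -/
structure StarredQuiver (N S : Type*) where
  /-- there is an arrow from the first vertex to the second one -/
  Arr : N ⊕ S → N ⊕ S → Prop
  ne_of_arr : ∀ x y, Arr x y → x ≠ y
  not_star_star : ∀ s s' : S, ¬ Arr (Sum.inr s) (Sum.inr s')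

open Classical in
/-- The vector of a vertex: the standard basis vector for a normal vertex, zero for a starred one. -/
noncomputable def vertexVector {N S : Type*} : N ⊕ S → (N → ℝ)
  | Sum.inl i => Pi.single i 1
  | Sum.inr _ => 0

/-- The root polytope: the convex hull of the points `u_a`, which are `e_j - e_i` for an arrow
`υ_i → υ_j`, `e_j` for `⋆ → υ_j` and `-e_i` for `υ_i → ⋆`. -/
def StarredQuiver.rootPolytope {N S : Type*} (Q : StarredQuiver N S) : Set (N → ℝ) :=
  convexHull ℝ {u | ∃ x y, Q.Arr x y ∧ u = vertexVector y - vertexVector x}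

/-! ### Quivers and flow polytopes

The arrow set of a quiver `V` is `Quiver.Total V`; an arrow `a` has source `a.left` and target
`a.right`. -/

/-- There are no oriented cycles: every closed oriented path is trivial. -/
def Quiver.IsAcyclic (V : Type*) [Quiver V] : Prop :=
  ∀ (v : V) (p : Quiver.Path v v), p.length = 0

/-- The underlying graph is connected (and has a vertex). -/
def Quiver.IsConnected (V : Type*) [Quiver V] : Prop :=
  Nonempty V ∧ ∀ v w : V, Nonempty (@Quiver.Path (Quiver.Symmetrify V) _ v w)

open Classical in
/-- The space `V_Q ⊆ ℝ^{Q₁}` of flows: at each vertex the incoming and the outgoing sums agree. -/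
def flowSpace (V : Type*) [Quiver V] [Fintype (Quiver.Total V)] :
    Submodule ℝ (Quiver.Total V → ℝ) where
  carrier := {r | ∀ q : V, ∑ a with a.right = q, r a = ∑ b with b.left = q, r b}
  zero_mem' := fun q => by simp
  add_mem' := fun {r s} hr hs q => by
    have h1 := hr q
    have h2 := hs q
    simp only [Pi.add_apply, Finset.sum_add_distrib, h1, h2]
  smul_mem' := fun c r hr q => by
    have h1 := hr q
    simp only [Pi.smul_apply, smul_eq_mul, ← Finset.mul_sum, h1]

/-- The lattice of integer points of `V_Q`. -/
def flowLattice (V : Type*) [Quiver V] [Fintype (Quiver.Total V)] : AddSubgroup (flowSpace V) :=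
  (integerLattice (Quiver.Total V)).comap (flowSpace V).subtype.toAddMonoidHom

/-- The flow polytope `Fl_Q = {r ∈ V_Q | r_a ≥ -1 for all arrows a}`. -/
def flowPolytope (V : Type*) [Quiver V] [Fintype (Quiver.Total V)] : Set (flowSpace V) :=
  {r | ∀ a, -1 ≤ (r : Quiver.Total V → ℝ) a}

/-! ### Plane quivers and their duals

The plane is `ℂ = ℝ²`, and multiplication by `I` is the rotation by a right angle to the left. -/

/-- `γ : [0,1] → ℝ²` is a regular piecewise continuously differentiable simple arc: continuous,
injective, and, away from finitely many breakpoints, continuously differentiable with nonzero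
velocity, the one-sided derivatives at breakpoints and ends included. -/
structure IsSimpleArc (γ : ℝ → ℂ) : Prop where
  continuousOn : ContinuousOn γ (Set.Icc 0 1)
  injOn : Set.InjOn γ (Set.Icc 0 1)
  piecewise : ∃ S : Finset ℝ, ∀ s t : ℝ, 0 ≤ s → s < t → t ≤ 1 → (∀ x ∈ S, x ∉ Set.Ioo s t) →
    ContDiffOn ℝ 1 γ (Set.Icc s t) ∧ ∀ x ∈ Set.Icc s t, derivWithin γ (Set.Icc s t) x ≠ 0

/-- An embedding of a quiver into the plane. Vertices are distinct points, each arrow is a simple arc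
from its source to its target, and an arc meets vertices and other arcs only in its end points. -/
structure PlaneEmbedding (V : Type*) [Quiver V] where
  /-- the position of a vertex -/
  point : V → ℂ
  /-- the arc of an arrow, parametrized by `[0,1]` -/
  arc : Quiver.Total V → ℝ → ℂ
  point_injective : Function.Injective point
  isSimpleArc : ∀ a, IsSimpleArc (arc a)
  arc_zero : ∀ a, arc a 0 = point a.left
  arc_one : ∀ a, arc a 1 = point a.right
  arc_ne_point : ∀ a, ∀ t ∈ Set.Ioo (0 : ℝ) 1, ∀ v, arc a t ≠ point v
  arc_ne_arc : ∀ a b, a ≠ b → ∀ s ∈ Set.Ioo (0 : ℝ) 1, ∀ t ∈ Set.Ioo (0 : ℝ) 1, arc a s ≠ arc b t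

namespace PlaneEmbedding

variable {V : Type*} [Quiver V] (D : PlaneEmbedding V)

/-- The subset of the plane covered by the vertices and the arrows. -/
def carrier : Set ℂ :=
  Set.range D.point ∪ ⋃ a, D.arc a '' Set.Icc 0 1

/-- The regions of the plane quiver: the connected components of the complement of the drawing. -/
def Region : Type :=
  {U : Set ℂ // ∃ p ∈ D.carrierᶜ, U = connectedComponentIn D.carrierᶜ p}

/-- The set `Q₂` of bounded regions. -/
def BoundedRegion : Type :=
  {U : D.Region // Bornology.IsBounded U.1}

/-- The region `U` lies to the left of the arrow `a`: at some point in the interior of the arc with a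
nonzero velocity, the points slightly to the left belong to `U`. -/
def IsLeftRegion (a : Quiver.Total V) (U : D.Region) : Prop :=
  ∃ t ∈ Set.Ioo (0 : ℝ) 1, deriv (D.arc a) t ≠ 0 ∧
    ∃ δ > (0 : ℝ), ∀ ε ∈ Set.Ioo 0 δ, D.arc a t + ε * (Complex.I * deriv (D.arc a) t) ∈ U.1

/-- The region `U` lies to the right of the arrow `a`. -/
def IsRightRegion (a : Quiver.Total V) (U : D.Region) : Prop :=
  ∃ t ∈ Set.Ioo (0 : ℝ) 1, deriv (D.arc a) t ≠ 0 ∧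
    ∃ δ > (0 : ℝ), ∀ ε ∈ Set.Ioo 0 δ, D.arc a t - ε * (Complex.I * deriv (D.arc a) t) ∈ U.1

open Classical in
/-- The vertex of the dual quiver in a region: a normal vertex if the region is bounded, and the
starred vertex if it is unbounded. -/
noncomputable def dualVertex (U : D.Region) : D.BoundedRegion ⊕ Unit :=
  if h : Bornology.IsBounded U.1 then Sum.inl ⟨U, h⟩ else Sum.inr ()

/-- The dual starred quiver: for each arrow that separates two different regions, there is a dual
arrow crossing it from left to right. -/
def dual : StarredQuiver D.BoundedRegion Unit where
  Arr x y := x ≠ y ∧ ∃ (a : Quiver.Total V) (L R : D.Region),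
    D.IsLeftRegion a L ∧ D.IsRightRegion a R ∧ x = D.dualVertex L ∧ y = D.dualVertex R
  ne_of_arr := fun _ _ h => h.1
  not_star_star := fun _ _ h => h.1 rfl

end PlaneEmbedding

/-!
The flow polytope and the root polytope are compared by winding numbers. A flow `r` is a real
`1`-cycle in the drawing, and its winding number `∑ r_a w_a(z)` around a point `z` is constant on
every region and zero on the unbounded ones. This gives a linear map from the space of flows to
`ℝ^{Q₂}` (`PlaneEmbedding.windingMap`), which turns out to be an isomorphism of lattices.

* It is injective and reflects integrality, because crossing an arrow `a` from left to right lowers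
  the winding number by `r_a` (`PlaneEmbedding.winding_left_sub_right`). The boundary values on
  both sides of an arc `γ` are computed by a continuous logarithm of the chords `γ v - γ u`, `u < v`
  (`tendsto_logIncrement_normal`). The resulting expression does not notice corners or cusps of
  `γ`, so no local analysis of the drawing at breakpoints or vertices is needed, and it does not
  matter that `IsLeftRegion` and `IsRightRegion` may use different points of the arc.
* It maps integral flows to integral vectors, since `exp (2πi w_a(z))` is, up to a positive factor,
  `(target - z) / (source - z)` and these quotients cancel around a cycle.
* It is surjective, because the winding numbers around distinct bounded regions are linearly
  independent (`PlaneEmbedding.linearIndependent_winding`). This replaces Euler's formula and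
  follows Borsuk's criterion: an integral relation with coefficients `y_U` makes
  `∏ (w - z_U) ^ y_U` the exponential of a continuous function on the drawing, and Tietze's theorem
  and the absence of a logarithm of `(w - z_U) ^ y_U` on a large circle force `y_U = 0`.

So a flow is the same as a height function on the regions that vanishes on the unbounded one, and
`r_a` is the difference of the heights on the two sides of `a`. The dual of this isomorphism
carries `e_w - e_v`, for a dual arrow `v → w` that crosses `a`, to the coordinate functional
`r ↦ r_a` (`heightDualEquiv_sub`).

The rest is convex geometry. Acyclicity gives a function on the vertices that increases along the
arrows; its increments are positive weights `c_a` with `∑ c_a r_a = 0` for all flows. Therefore the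
flow polytope is compact, and zero is a convex combination of the coordinate functionals. The
polytope has integral extreme points, because the heights with a common nonzero fractional part can
be shifted simultaneously (`extremePoints_flowPolytope_subset`). Its polar dual is the convex hull
of zero and the coordinate functionals (`polarDual_flowPolytope`), hence a lattice polytope, and
the image of the root polytope as soon as there is a bounded region.
-/

/-! ### Continuous logarithms -/

/-- A convex subset of a normed space is locally path connected. -/
theorem Convex.locallyPathConnectedSpace_coe {E : Type*} [NormedAddCommGroup E] [NormedSpace ℝ E]
    {C : Set E} (hC : Convex ℝ C) : LocallyPathConnectedSpace C := by
  refine LocallyPathConnectedSpace.of_bases (p := fun _ (r : ℝ) => 0 < r)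
    (s := fun x r => Metric.ball x r) (fun x => Metric.nhds_basis_ball) fun x r hr => ?_
  rw [Topology.IsInducing.subtypeVal.isPathConnected_iff, Subtype.image_ball]
  exact ((convex_ball _ _).inter hC).isPathConnected ⟨x, Metric.mem_ball_self hr, x.2⟩

/-- `g` is a continuous logarithm of `f` on the set `S`. -/
structure IsLogOn {X : Type*} [TopologicalSpace X] (g f : X → ℂ) (S : Set X) : Prop where
  continuousOn : ContinuousOn g S
  exp_eq : ∀ x ∈ S, Complex.exp (g x) = f x

theorem exists_isLogOn {E : Type*} [NormedAddCommGroup E] [NormedSpace ℝ E] {C : Set E}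
    (hC : Convex ℝ C) {f : E → ℂ} (hf : ContinuousOn f C) (h0 : ∀ x ∈ C, f x ≠ 0) :
    ∃ g, IsLogOn g f C := by
  classical
  rcases C.eq_empty_or_nonempty with rfl | ⟨x₀, hx₀⟩
  · exact ⟨0, continuousOn_empty _, by simp⟩
  have := hC.locallyPathConnectedSpace_coe
  have := hC.contractibleSpace ⟨x₀, hx₀⟩
  obtain ⟨F, ⟨-, hF⟩, -⟩ := Complex.isCoveringMapOn_exp.existsUnique_continuousMap_lifts
    ⟨C.domRestrict f, continuousOn_iff_continuous_domRestrict.mp hf⟩ (a₀ := ⟨x₀, hx₀⟩)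
    (Complex.exp_log (h0 x₀ hx₀)) (fun x => h0 x x.2)
  refine ⟨fun x => if h : x ∈ C then F ⟨x, h⟩ else 0, ?_, fun x hx => ?_⟩
  · rw [continuousOn_iff_continuous_domRestrict]
    convert map_continuous F using 1
    ext x
    simp
  · simpa [hx] using congrFun hF ⟨x, hx⟩

/-- A continuous function on a connected set with `exp f = 1` is constant. -/
theorem IsPreconnected.eq_of_exp_eq_one {X : Type*} [TopologicalSpace X] {S : Set X}
    (hS : IsPreconnected S) {f : X → ℂ} (hf : ContinuousOn f S)
    (h1 : ∀ x ∈ S, Complex.exp (f x) = 1) {x y : X} (hx : x ∈ S) (hy : y ∈ S) : f x = f y := by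
  have hr : ∀ z ∈ S, ∃ n : ℤ, f z = n * (2 * Real.pi * Complex.I) := fun z hz =>
    Complex.exp_eq_one_iff.1 (h1 z hz)
  have hpi : (2 * Real.pi * Complex.I : ℂ) ≠ 0 := by simp [Real.pi_ne_zero]
  have hc : ContinuousOn (fun z => (f z / (2 * Real.pi * Complex.I)).re) S :=
    Complex.continuous_re.comp_continuousOn (hf.div_const _)
  have hm : Set.MapsTo (fun z => (f z / (2 * Real.pi * Complex.I)).re) S
      (Set.range ((↑) : ℤ → ℝ)) := by
    intro z hz
    obtain ⟨n, hn⟩ := hr z hz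
    refine ⟨n, ?_⟩
    simp only
    rw [hn, mul_div_assoc, div_self hpi]
    simp
  have hd : DiscreteTopology (Set.range ((↑) : ℤ → ℝ)) :=
    (Int.isClosedEmbedding_coe_real.isEmbedding.toHomeomorph.symm.isEmbedding).discreteTopology
  have hxy := hS.constant_of_mapsTo ⟨hd⟩ hc hm hx hy
  obtain ⟨n, hn⟩ := hr x hx
  obtain ⟨m, hm⟩ := hr y hy
  simp only [hn, hm, mul_div_assoc, div_self hpi] at hxy
  simp only [mul_one, Complex.intCast_re] at hxy
  rw [hn, hm]
  norm_cast at hxy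
  rw [hxy]

theorem IsLogOn.mono {X : Type*} [TopologicalSpace X] {g f : X → ℂ} {S T : Set X}
    (h : IsLogOn g f S) (hT : T ⊆ S) : IsLogOn g f T :=
  ⟨h.continuousOn.mono hT, fun x hx => h.exp_eq x (hT hx)⟩

theorem IsLogOn.ne_zero {X : Type*} [TopologicalSpace X] {g f : X → ℂ} {S : Set X}
    (h : IsLogOn g f S) {x : X} (hx : x ∈ S) : f x ≠ 0 :=
  h.exp_eq x hx ▸ Complex.exp_ne_zero _

/-- The increment of a continuous logarithm over a connected set depends only on the function,
and only up to a constant factor. -/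
theorem IsLogOn.sub_eq_sub {X : Type*} [TopologicalSpace X] {g f g' f' : X → ℂ} {S : Set X}
    (hS : IsPreconnected S) (h : IsLogOn g f S) (h' : IsLogOn g' f' S) {c : ℂ} (hc : c ≠ 0)
    (hff' : ∀ x ∈ S, f x = c * f' x) {x y : X} (hx : x ∈ S) (hy : y ∈ S) :
    g x - g y = g' x - g' y := by
  have := hS.eq_of_exp_eq_one (f := fun z => g z - g' z - Complex.log c)
    ((h.continuousOn.sub h'.continuousOn).sub continuousOn_const) (fun z hz => by
      rw [Complex.exp_sub, Complex.exp_sub, h.exp_eq z hz, h'.exp_eq z hz, Complex.exp_log hc,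
        hff' z hz, mul_div_cancel_right₀ _ (h'.ne_zero hz), div_self hc]) hx hy
  linear_combination this

theorem one_add_div_mem_slitPlane {c w : ℂ} (h : ‖c‖ < ‖w‖) : 1 + c / w ∈ Complex.slitPlane := by
  have hw : 0 < ‖w‖ := (norm_nonneg _).trans_lt h
  refine Or.inl ?_
  have h1 : |(c / w).re| < 1 := (Complex.abs_re_le_norm _).trans_lt (by
    rw [norm_div]; exact (div_lt_one hw).2 h)
  have := (abs_lt.1 h1).1
  simp only [Complex.add_re, Complex.one_re]
  linarith

/-- A small translation changes a continuous logarithm by a principal logarithm. -/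
theorem IsLogOn.add_const {X : Type*} [TopologicalSpace X] {g f : X → ℂ} {S : Set X}
    (h : IsLogOn g f S) (hf : ContinuousOn f S) {c : ℂ} (hc : ∀ x ∈ S, ‖c‖ < ‖f x‖) :
    IsLogOn (fun x => g x + Complex.log (1 + c / f x)) (fun x => f x + c) S where
  continuousOn := h.continuousOn.add
    ((continuousOn_const.add (continuousOn_const.div hf fun _ hx => h.ne_zero hx)).clog
      fun x hx => one_add_div_mem_slitPlane (hc x hx))
  exp_eq x hx := by
    have h0 := h.ne_zero hx
    rw [Complex.exp_add, h.exp_eq x hx,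
      Complex.exp_log (Complex.slitPlane_ne_zero (one_add_div_mem_slitPlane (hc x hx)))]
    field_simp

open Classical in
/-- The increment over `[0,1]` of a continuous logarithm of `f`, and zero if there is none. -/
noncomputable def logIncrement (f : ℝ → ℂ) : ℂ :=
  if h : ∃ g, IsLogOn g f (Set.Icc 0 1) then h.choose 1 - h.choose 0 else 0

theorem IsLogOn.logIncrement_eq {f g : ℝ → ℂ} (h : IsLogOn g f (Set.Icc 0 1)) :
    logIncrement f = g 1 - g 0 := by
  have hex : ∃ g, IsLogOn g f (Set.Icc 0 1) := ⟨g, h⟩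
  rw [logIncrement, dif_pos hex]
  exact hex.choose_spec.sub_eq_sub isPreconnected_Icc h one_ne_zero (by simp) (by simp) (by simp)

theorem exists_isLogOn_Icc {f : ℝ → ℂ} (hf : ContinuousOn f (Set.Icc 0 1))
    (h0 : ∀ x ∈ Set.Icc (0 : ℝ) 1, f x ≠ 0) : ∃ g, IsLogOn g f (Set.Icc 0 1) :=
  exists_isLogOn (convex_Icc 0 1) hf h0

theorem exp_logIncrement {f : ℝ → ℂ} (hf : ContinuousOn f (Set.Icc 0 1))
    (h0 : ∀ x ∈ Set.Icc (0 : ℝ) 1, f x ≠ 0) : Complex.exp (logIncrement f) = f 1 / f 0 := by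
  obtain ⟨g, hg⟩ := exists_isLogOn_Icc hf h0
  rw [hg.logIncrement_eq, Complex.exp_sub, hg.exp_eq 1 (by simp), hg.exp_eq 0 (by simp)]

theorem logIncrement_add_const {f : ℝ → ℂ} (hf : ContinuousOn f (Set.Icc 0 1)) {c : ℂ}
    (hc : ∀ x ∈ Set.Icc (0 : ℝ) 1, ‖c‖ < ‖f x‖) :
    logIncrement (fun x => f x + c) =
      logIncrement f + (Complex.log (1 + c / f 1) - Complex.log (1 + c / f 0)) := by
  obtain ⟨g, hg⟩ := exists_isLogOn_Icc hf
    (fun x hx => norm_pos_iff.1 ((norm_nonneg _).trans_lt (hc x hx)))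
  rw [hg.logIncrement_eq, (hg.add_const hf hc).logIncrement_eq]
  ring

/-! ### The logarithm of the chords of a simple arc -/

/-- The pairs of parameters `0 ≤ u < v ≤ 1`. -/
def chordDomain : Set (ℝ × ℝ) :=
  (Set.Icc 0 1 ×ˢ Set.Icc 0 1) ∩ {p | p.1 < p.2}

theorem convex_setOf_fst_lt_snd : Convex ℝ {p : ℝ × ℝ | p.1 < p.2} := by
  have h : {p : ℝ × ℝ | p.1 < p.2} =
      (LinearMap.snd ℝ ℝ ℝ - LinearMap.fst ℝ ℝ ℝ) ⁻¹' Set.Ioi 0 := by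
    ext p
    simp
  rw [h]
  exact (convex_Ioi (0 : ℝ)).linear_preimage _

theorem mem_chordDomain {u v : ℝ} : (u, v) ∈ chordDomain ↔ 0 ≤ u ∧ u < v ∧ v ≤ 1 := by
  simp only [chordDomain, Set.mem_inter_iff, Set.mem_prod, Set.mem_Icc, Set.mem_ofPred_eq]
  constructor
  · rintro ⟨⟨⟨h1, h2⟩, h3, h4⟩, h5⟩; exact ⟨h1, h5, h4⟩
  · rintro ⟨h1, h5, h4⟩; exact ⟨⟨⟨h1, by linarith⟩, by linarith, h4⟩, h5⟩

/-- The chords `γ v - γ u`, for `u < v`, of a simple arc have a continuous logarithm, since their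
parameters form a convex set. -/
theorem exists_isLogOn_chord {γ : ℝ → ℂ} (hγ : ContinuousOn γ (Set.Icc 0 1))
    (hinj : Set.InjOn γ (Set.Icc 0 1)) :
    ∃ Λ : ℝ × ℝ → ℂ, IsLogOn Λ (fun p => γ p.2 - γ p.1) chordDomain := by
  refine exists_isLogOn (((convex_Icc 0 1).prod (convex_Icc 0 1)).inter convex_setOf_fst_lt_snd)
    ?_ ?_
  · exact (hγ.comp continuousOn_snd fun p hp => hp.1.2).sub
      (hγ.comp continuousOn_fst fun p hp => hp.1.1)
  · intro p hp h
    exact (ne_of_gt hp.2) (hinj hp.1.2 hp.1.1 (sub_eq_zero.1 h))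

theorem Complex.log_I_mul_of_re_pos {w : ℂ} (hw : 0 < w.re) {σ : ℝ} (hσ : σ = 1 ∨ σ = -1) :
    Complex.log (σ * Complex.I * w) = σ * (Real.pi / 2) * Complex.I + Complex.log w := by
  have hw0 : w ≠ 0 := by rintro rfl; simp at hw
  have harg := abs_lt.1 (Complex.abs_arg_lt_pi_div_two_iff.2 (Or.inl hw))
  have hpi := Real.pi_pos
  rcases hσ with rfl | rfl
  · rw [Complex.log_mul_eq_add_log_iff (by simp) hw0 |>.2]
    · simp [Complex.log_I]
    · simp only [Complex.ofReal_one, one_mul, Complex.arg_I, Set.mem_Ioc]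
      constructor <;> linarith
  · rw [Complex.log_mul_eq_add_log_iff (by simp) hw0 |>.2]
    · simp [Complex.log_neg_I]
    · simp only [Complex.ofReal_neg, Complex.ofReal_one, neg_mul, one_mul, Complex.arg_neg_I,
        Set.mem_Ioc]
      constructor <;> linarith

/-- The boundary values of the winding of a simple arc `γ` around points that approach `γ t` along
the normal, from the left for `σ = 1` and from the right for `σ = -1`. Both are given by the
logarithm `Λ` of the chords of `γ`, up to the half turn made while passing `γ t`; the expression
`Λ (t, 1) - Λ (0, t)` is continuous in `t`, corners and cusps of `γ` included. -/
theorem tendsto_logIncrement_normal {γ : ℝ → ℂ} (hγ : ContinuousOn γ (Set.Icc 0 1))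
    (hinj : Set.InjOn γ (Set.Icc 0 1)) {t : ℝ} (ht : t ∈ Set.Ioo (0 : ℝ) 1) {d : ℂ}
    (hd : HasDerivAt γ d t) (hd0 : d ≠ 0) {Λ : ℝ × ℝ → ℂ}
    (hΛ : IsLogOn Λ (fun p => γ p.2 - γ p.1) chordDomain) {σ : ℝ} (hσ : σ = 1 ∨ σ = -1) :
    Filter.Tendsto (fun ε : ℝ => logIncrement (fun s => γ s - (γ t + σ * (ε * (Complex.I * d)))))
      (nhdsWithin 0 (Set.Ioi 0))
      (nhds (Λ (t, 1) - Λ (0, t) + σ * Real.pi * Complex.I)) := by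
  obtain ⟨ht0, ht1⟩ := ht
  have hσ2 : (σ : ℂ) * σ = 1 := by rcases hσ with rfl | rfl <;> simp
  have hσ0 : σ ≠ 0 := by rcases hσ with rfl | rfl <;> simp
  -- the arc in the coordinate in which its velocity at `t` is `1`
  set ρ : ℝ → ℂ := fun s => (γ s - γ t) / d with hρ
  have hρt : ρ t = 0 := by simp [hρ]
  have hγρ : ∀ s, γ s - γ t = d * ρ s := fun s => by simp only [hρ]; field_simp
  obtain ⟨δ, hδ, hδ0, hδ1, hre⟩ : ∃ δ > 0, δ < t ∧ δ < 1 - t ∧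
      ∀ s, |s - t| ≤ δ → |(ρ s).re - (s - t)| ≤ |s - t| / 2 := by
    have hder : HasDerivAt ρ 1 t := by
      have := (hd.sub_const (γ t)).div_const d
      rwa [div_self hd0] at this
    have hev := (hasDerivAt_iff_isLittleO.1 hder).def (c := 1 / 2) (by norm_num)
    obtain ⟨δ, hδ, hball⟩ := Metric.eventually_nhds_iff_ball.1 hev
    refine ⟨min (δ / 2) (min (t / 2) ((1 - t) / 2)), ?_, ?_, ?_, ?_⟩
    · refine lt_min (by linarith) (lt_min ?_ ?_) <;> linarith
    · exact ((min_le_right _ _).trans (min_le_left _ _)).trans_lt (by linarith)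
    · exact ((min_le_right _ _).trans (min_le_right _ _)).trans_lt (by linarith)
    · intro s hs
      have := hball s (by
        rw [Metric.mem_ball, Real.dist_eq]
        exact (hs.trans (min_le_left _ _)).trans_lt (by linarith))
      rw [hρt, sub_zero, Real.norm_eq_abs] at this
      refine le_trans ?_ (this.trans_eq (by ring))
      refine le_trans (le_of_eq ?_) (Complex.abs_re_le_norm _)
      simp
  have hpos : ∀ s, t < s → s ≤ t + δ → 0 < (ρ s).re := fun s h1 h2 => by
    have h3 := hre s (by rw [abs_of_pos (by linarith)]; linarith)
    rw [abs_of_pos (show 0 < s - t by linarith)] at h3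
    linarith [(abs_le.1 h3).1]
  have hneg : ∀ s, s < t → t - δ ≤ s → (ρ s).re < 0 := fun s h1 h2 => by
    have h3 := hre s (by rw [abs_of_neg (by linarith)]; linarith)
    rw [abs_of_neg (show s - t < 0 by linarith)] at h3
    linarith [(abs_le.1 h3).2]
  have hρc : ContinuousOn ρ (Set.Icc 0 1) := (hγ.sub continuousOn_const).div_const _
  set s₁ := t - δ with hs₁
  set s₂ := t + δ with hs₂
  have hp₂ := hpos s₂ (by linarith) le_rfl
  have hp₁ := hneg s₁ (by linarith) le_rfl
  -- the chords across `t`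
  have hchord : Λ (s₁, t) - Λ (t, s₂) = Complex.log (-ρ s₁) - Complex.log (ρ s₂) := by
    set S : Set (ℝ × ℝ) := (Set.Icc s₁ t ×ˢ Set.Icc t s₂) ∩ {p | p.1 < p.2}
    have hSc : IsPreconnected S := (((convex_Icc s₁ t).prod (convex_Icc t s₂)).inter
      convex_setOf_fst_lt_snd).isPreconnected
    have hSsub : S ⊆ chordDomain := by
      rintro ⟨u, v⟩ ⟨⟨⟨h1, h2⟩, h3, h4⟩, h5⟩
      simp only at h1 h2 h3 h4
      exact mem_chordDomain.2 ⟨by linarith, h5, by linarith⟩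
    have hlog : IsLogOn (fun p : ℝ × ℝ => Complex.log (ρ p.2 - ρ p.1)) (fun p => ρ p.2 - ρ p.1)
        S := by
      have hsl : ∀ p ∈ S, ρ p.2 - ρ p.1 ∈ Complex.slitPlane := by
        rintro ⟨u, v⟩ ⟨⟨⟨h1, h2⟩, h3, h4⟩, h5⟩
        simp only [Set.mem_ofPred_eq] at h1 h2 h3 h4 h5
        refine Or.inl ?_
        simp only [Complex.sub_re]
        rcases h2.lt_or_eq with h2 | rfl
        · have := hneg u h2 h1
          rcases h3.lt_or_eq with h3 | rfl
          · linarith [hpos v h3 h4]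
          · simp only [hρt, Complex.zero_re]; linarith
        · have := hpos v h5 h4
          simp only [hρt, Complex.zero_re]; linarith
      have hmem := fun p hp => hSsub (a := p) hp
      refine ⟨ContinuousOn.clog ?_ hsl, fun p hp => Complex.exp_log
        (Complex.slitPlane_ne_zero (hsl p hp))⟩
      exact (hρc.comp continuousOn_snd fun p hp => (hmem p hp).1.2).sub
        (hρc.comp continuousOn_fst fun p hp => (hmem p hp).1.1)
    have := (hΛ.mono hSsub).sub_eq_sub hSc hlog hd0 (fun p _ => by
      simp only [hρ]; field_simp; ring) (x := (s₁, t)) (y := (t, s₂))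
      ⟨⟨⟨le_rfl, by linarith⟩, le_rfl, by linarith⟩, show s₁ < t by linarith⟩
      ⟨⟨⟨by linarith, le_rfl⟩, by linarith, le_rfl⟩, show t < s₂ by linarith⟩
    simpa [hρt] using this
  -- the arc stays away from `γ t` outside of `(s₁, s₂)`
  obtain ⟨m, hm, hfar⟩ : ∃ m > 0, ∀ s ∈ Set.Icc 0 s₁ ∪ Set.Icc s₂ 1, m < ‖γ s - γ t‖ := by
    have hK : IsCompact (Set.Icc 0 s₁ ∪ Set.Icc s₂ 1) := isCompact_Icc.union isCompact_Icc
    have hsub : Set.Icc 0 s₁ ∪ Set.Icc s₂ 1 ⊆ Set.Icc 0 1 := by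
      rintro s (⟨h1, h2⟩ | ⟨h1, h2⟩) <;> constructor <;> linarith
    have hc : ContinuousOn (fun s => ‖γ s - γ t‖) (Set.Icc 0 s₁ ∪ Set.Icc s₂ 1) :=
      ((hγ.mono hsub).sub continuousOn_const).norm
    obtain ⟨x, hx, hmin⟩ := hK.exists_isMinOn ⟨0, Or.inl ⟨le_rfl, by linarith⟩⟩ hc
    have hx0 : 0 < ‖γ x - γ t‖ := by
      rw [norm_pos_iff, sub_ne_zero]
      intro h
      have := hinj (hsub hx) ⟨ht0.le, ht1.le⟩ h
      rcases hx with ⟨h1, h2⟩ | ⟨h1, h2⟩ <;> linarith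
    exact ⟨‖γ x - γ t‖ / 2, by linarith, fun s hs => by
      have : ‖γ x - γ t‖ ≤ ‖γ s - γ t‖ := hmin hs
      linarith⟩
  set w : ℝ → ℂ := fun ε => σ * (ε * (Complex.I * d)) with hw
  have hwc : Continuous w := by fun_prop
  have hw0 : w 0 = 0 := by simp [hw]
  have hwsmall : ∀ᶠ ε in nhdsWithin (0 : ℝ) (Set.Ioi 0), ‖w ε‖ < m := by
    have h1 : Filter.Tendsto (fun ε => ‖w ε‖) (nhds 0) (nhds 0) := by
      have := hwc.norm.tendsto 0
      rwa [hw0, norm_zero] at this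
    exact (h1.mono_left nhdsWithin_le_nhds).eventually_lt_const hm
  have hformula : ∀ᶠ ε in nhdsWithin (0 : ℝ) (Set.Ioi 0),
      (Λ (s₁, t) + Complex.log (1 + w ε / (γ t - γ s₁)) -
          (Λ (0, t) + Complex.log (1 + w ε / (γ t - γ 0)))) +
        (Complex.log (σ * Complex.I * ρ s₂ + ε) - Complex.log (σ * Complex.I * ρ s₁ + ε)) +
        (Λ (t, 1) + Complex.log (1 + -w ε / (γ 1 - γ t)) -
          (Λ (t, s₂) + Complex.log (1 + -w ε / (γ s₂ - γ t)))) =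
      logIncrement (fun s => γ s - (γ t + w ε)) := by
    filter_upwards [hwsmall, self_mem_nhdsWithin] with ε hε hε0
    rw [Set.mem_Ioi] at hε0
    have hsl : ∀ s ∈ Set.Icc s₁ s₂, σ * Complex.I * ρ s + ε ∈ Complex.slitPlane := by
      rintro s ⟨h1, h2⟩
      rcases lt_trichotomy s t with h | rfl | h
      · refine Or.inr ?_
        have := hneg s h h1
        simp [hσ0, this.ne]
      · refine Or.inl ?_
        simpa [hρt] using hε0
      · refine Or.inr ?_
        have := hpos s h h2
        simp [hσ0, this.ne']
    have hmid : ∀ s, γ s - (γ t + w ε) = -(σ * Complex.I) * d * (σ * Complex.I * ρ s + ε) := by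
      intro s
      have h1 := hγρ s
      simp only [hw]
      linear_combination h1 + d * ρ s * Complex.I * Complex.I * hσ2 + d * ρ s * Complex.I_mul_I
    have hne : ∀ s ∈ Set.Icc (0 : ℝ) 1, γ s - (γ t + w ε) ≠ 0 := by
      rintro s ⟨h1, h2⟩
      by_cases h : s ∈ Set.Icc s₁ s₂
      · rw [hmid]
        exact mul_ne_zero (by simp [hσ0, hd0]) (Complex.slitPlane_ne_zero (hsl s h))
      · intro h0
        have h3 : γ s - γ t = w ε := by linear_combination h0
        have h4 := hfar s (by
          simp only [Set.mem_Icc, not_and_or, not_le] at h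
          rcases h with h | h
          · exact Or.inl ⟨h1, h.le⟩
          · exact Or.inr ⟨h.le, h2⟩)
        rw [h3] at h4
        linarith
    obtain ⟨G, hG⟩ := exists_isLogOn_Icc (f := fun s => γ s - (γ t + w ε))
      (hγ.sub continuousOn_const) hne
    rw [hG.logIncrement_eq]
    have e2 := (hG.mono (Set.Icc_subset_Icc (show 0 ≤ s₁ by linarith)
        (show s₂ ≤ 1 by linarith))).sub_eq_sub isPreconnected_Icc
      (g' := fun s => Complex.log (σ * Complex.I * ρ s + ε))
      (f' := fun s => σ * Complex.I * ρ s + ε)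
      ⟨((continuousOn_const.mul (hρc.mono (Set.Icc_subset_Icc (show 0 ≤ s₁ by linarith)
        (show s₂ ≤ 1 by linarith)))).add continuousOn_const).clog hsl,
        fun s hs => Complex.exp_log (Complex.slitPlane_ne_zero (hsl s hs))⟩
      (c := -(σ * Complex.I) * d) (by simp [hσ0, hd0]) (fun s _ => hmid s)
      (x := s₂) (y := s₁) ⟨by linarith, le_rfl⟩ ⟨le_rfl, by linarith⟩
    have hsub1 : Set.Icc 0 s₁ ⊆ Set.Icc (0 : ℝ) 1 := Set.Icc_subset_Icc le_rfl (by linarith)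
    have hsub3 : Set.Icc s₂ 1 ⊆ Set.Icc (0 : ℝ) 1 := Set.Icc_subset_Icc (by linarith) le_rfl
    have l1 : IsLogOn (fun s => Λ (s, t)) (fun s => γ t - γ s) (Set.Icc 0 s₁) :=
      ⟨hΛ.continuousOn.comp (by fun_prop)
        fun s hs => mem_chordDomain.2 ⟨hs.1, by linarith [hs.2], ht1.le⟩,
        fun s hs => hΛ.exp_eq (s, t) (mem_chordDomain.2 ⟨hs.1, by linarith [hs.2], ht1.le⟩)⟩
    have l3 : IsLogOn (fun s => Λ (t, s)) (fun s => γ s - γ t) (Set.Icc s₂ 1) :=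
      ⟨hΛ.continuousOn.comp (by fun_prop)
        fun s hs => mem_chordDomain.2 ⟨ht0.le, by linarith [hs.1], hs.2⟩,
        fun s hs => hΛ.exp_eq (t, s) (mem_chordDomain.2 ⟨ht0.le, by linarith [hs.1], hs.2⟩)⟩
    have e1 := (hG.mono hsub1).sub_eq_sub isPreconnected_Icc
      (l1.add_const (c := w ε) (continuousOn_const.sub (hγ.mono hsub1)) (fun s hs => by
        rw [norm_sub_rev]
        exact hε.trans (hfar s (Or.inl hs))))
      (c := -1) (by simp) (fun s _ => by ring)
      (x := s₁) (y := 0) ⟨by linarith, le_rfl⟩ ⟨le_rfl, by linarith⟩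
    have e3 := (hG.mono hsub3).sub_eq_sub isPreconnected_Icc
      (l3.add_const (c := -w ε) ((hγ.mono hsub3).sub continuousOn_const) (fun s hs => by
        rw [norm_neg]
        exact hε.trans (hfar s (Or.inr hs))))
      (c := 1) (by simp) (fun s _ => by ring)
      (x := 1) (y := s₂) ⟨by linarith, le_rfl⟩ ⟨le_rfl, by linarith⟩
    rw [← e1, ← e2, ← e3]
    ring
  refine Filter.Tendsto.congr' hformula ?_
  have hsl₁ : σ * Complex.I * ρ s₁ ∈ Complex.slitPlane := Or.inr (by simp [hσ0, hp₁.ne])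
  have hsl₂ : σ * Complex.I * ρ s₂ ∈ Complex.slitPlane := Or.inr (by simp [hσ0, hp₂.ne'])
  have hlogt : ∀ (σ' : ℂ) (z : ℂ), Filter.Tendsto (fun ε => Complex.log (1 + σ' * w ε / z))
      (nhdsWithin 0 (Set.Ioi 0)) (nhds 0) := by
    intro σ' z
    have h1 : ContinuousAt (fun ε => Complex.log (1 + σ' * w ε / z)) 0 := by
      refine ContinuousAt.clog (by fun_prop) ?_
      simp [hw0]
    have h2 := h1.tendsto
    simp only [hw0, mul_zero, zero_div, add_zero, Complex.log_one] at h2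
    exact h2.mono_left nhdsWithin_le_nhds
  have hlogm : ∀ z : ℂ, z ∈ Complex.slitPlane → Filter.Tendsto (fun ε : ℝ => Complex.log (z + ε))
      (nhdsWithin 0 (Set.Ioi 0)) (nhds (Complex.log z)) := by
    intro z hz
    have h1 : ContinuousAt (fun ε : ℝ => Complex.log (z + ε)) 0 := by
      refine ContinuousAt.clog (by fun_prop) ?_
      simpa using hz
    have h2 := h1.tendsto
    simp only [Complex.ofReal_zero, add_zero] at h2
    exact h2.mono_left nhdsWithin_le_nhds
  have hl1 : ∀ z, Filter.Tendsto (fun ε => Complex.log (1 + w ε / z))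
      (nhdsWithin 0 (Set.Ioi 0)) (nhds 0) := fun z => by simpa using hlogt 1 z
  have hl2 : ∀ z, Filter.Tendsto (fun ε => Complex.log (1 + -w ε / z))
      (nhdsWithin 0 (Set.Ioi 0)) (nhds 0) := fun z => by simpa using hlogt (-1) z
  have hlim := (((tendsto_const_nhds (x := Λ (s₁, t))).add (hl1 (γ t - γ s₁))).sub
      ((tendsto_const_nhds (x := Λ (0, t))).add (hl1 (γ t - γ 0)))).add
    ((hlogm _ hsl₂).sub (hlogm _ hsl₁)) |>.add
    (((tendsto_const_nhds (x := Λ (t, 1))).add (hl2 (γ 1 - γ t))).sub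
      ((tendsto_const_nhds (x := Λ (t, s₂))).add (hl2 (γ s₂ - γ t))))
  convert hlim using 2
  have h2 := Complex.log_I_mul_of_re_pos hp₂ hσ
  have h1 := Complex.log_I_mul_of_re_pos (w := -ρ s₁) (by simpa using hp₁) (σ := -σ)
    (by rcases hσ with rfl | rfl <;> simp)
  have h1' : ((-σ : ℝ) : ℂ) * Complex.I * -ρ s₁ = σ * Complex.I * ρ s₁ := by push_cast; ring
  rw [h1'] at h1
  push_cast at h1
  linear_combination -hchord - h2 + h1

/-! ### Winding numbers of flows -/

theorem mem_flowSpace {V : Type*} [Quiver V] [Fintype (Quiver.Total V)]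
    {r : Quiver.Total V → ℝ} [DecidableEq V] : r ∈ flowSpace V ↔
      ∀ q : V, ∑ a with a.right = q, r a = ∑ b with b.left = q, r b := by
  refine forall_congr' fun q => ?_
  congr!

/-- A flow pairs to zero with every coboundary. -/
theorem sum_smul_sub_eq_zero {V M : Type*} [Quiver V] [Finite V] [Fintype (Quiver.Total V)]
    [AddCommGroup M] [Module ℝ M] {r : Quiver.Total V → ℝ} (hr : r ∈ flowSpace V) (f : V → M) :
    ∑ a, r a • (f a.right - f a.left) = 0 := by
  classical
  have := Fintype.ofFinite V
  simp only [smul_sub, Finset.sum_sub_distrib]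
  rw [← Finset.sum_fiberwise (s := Finset.univ) (g := fun a : Quiver.Total V => a.right),
    ← Finset.sum_fiberwise (s := Finset.univ) (g := fun a : Quiver.Total V => a.left), sub_eq_zero]
  refine Finset.sum_congr rfl fun q _ => ?_
  have h1 : ∀ g : Quiver.Total V → V, ∑ a with g a = q, r a • f (g a)
      = (∑ a with g a = q, r a) • f q := by
    intro g
    rw [Finset.sum_smul]
    refine Finset.sum_congr rfl fun a ha => ?_
    rw [(Finset.mem_filter.1 ha).2]
  rw [h1, h1, mem_flowSpace.1 hr q]

theorem continuousAt_logIncrement_sub {γ : ℝ → ℂ} (hγ : ContinuousOn γ (Set.Icc 0 1)) {z : ℂ}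
    (hz : ∀ s ∈ Set.Icc (0 : ℝ) 1, γ s ≠ z) :
    ContinuousAt (fun z => logIncrement (fun s => γ s - z)) z := by
  have hc : IsClosed (γ '' Set.Icc 0 1) := (isCompact_Icc.image_of_continuousOn hγ).isClosed
  have hz' : z ∈ (γ '' Set.Icc 0 1)ᶜ := by
    rintro ⟨s, hs, h⟩
    exact hz s hs h
  obtain ⟨d, hd, hball⟩ := Metric.isOpen_iff.1 hc.isOpen_compl z hz'
  have hev : (fun z' => logIncrement (fun s => γ s - z) +
      (Complex.log (1 + (z - z') / (γ 1 - z)) - Complex.log (1 + (z - z') / (γ 0 - z)))) =ᶠ[nhds z]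
      (fun z => logIncrement (fun s => γ s - z)) := by
    filter_upwards [Metric.ball_mem_nhds z hd] with z' hz'
    rw [← logIncrement_add_const (f := fun s => γ s - z) (hγ.sub continuousOn_const)]
    · simp
    · intro s hs
      by_contra! h
      refine hball (a := γ s) ?_ ⟨s, hs, rfl⟩
      rw [Metric.mem_ball, dist_eq_norm]
      rw [Metric.mem_ball, dist_comm, dist_eq_norm] at hz'
      exact h.trans_lt hz'
  refine ContinuousAt.congr ?_ hev
  have h1 : ∀ c : ℂ, ContinuousAt (fun z' => Complex.log (1 + (z - z') / c)) z := fun c =>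
    ContinuousAt.clog (by fun_prop) (by simp)
  exact continuousAt_const.add ((h1 _).sub (h1 _))

namespace PlaneEmbedding

variable {V : Type*} [Quiver V] (D : PlaneEmbedding V)

theorem arc_mem_carrier (a : Quiver.Total V) {s : ℝ} (hs : s ∈ Set.Icc (0 : ℝ) 1) :
    D.arc a s ∈ D.carrier :=
  Or.inr (Set.mem_iUnion.2 ⟨a, s, hs, rfl⟩)

theorem point_mem_carrier (v : V) : D.point v ∈ D.carrier := Or.inl ⟨v, rfl⟩

theorem isCompact_carrier [Finite V] [Finite (Quiver.Total V)] : IsCompact D.carrier :=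
  (Set.finite_range _).isCompact.union
    (isCompact_iUnion fun a => isCompact_Icc.image_of_continuousOn (D.isSimpleArc a).continuousOn)

/-- The winding number of an arc around `z`: the change of the argument of `w - z` along the
arc, in full turns. -/
noncomputable def arcWinding (a : Quiver.Total V) (z : ℂ) : ℝ :=
  (logIncrement (fun s => D.arc a s - z)).im / (2 * Real.pi)

/-- The winding number of the chain `∑ r_a a` around `z`. -/
noncomputable def winding [Fintype (Quiver.Total V)] (r : Quiver.Total V → ℝ) (z : ℂ) : ℝ :=
  ∑ a, r a * D.arcWinding a z

theorem winding_eq_im [Fintype (Quiver.Total V)] (r : Quiver.Total V → ℝ) (z : ℂ) :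
    D.winding r z = (∑ a, r a • logIncrement (fun s => D.arc a s - z)).im / (2 * Real.pi) := by
  rw [Complex.im_sum, Finset.sum_div]
  refine Finset.sum_congr rfl fun a _ => ?_
  rw [Complex.smul_im, smul_eq_mul, arcWinding, mul_div_assoc]

theorem winding_add [Fintype (Quiver.Total V)] (r s : Quiver.Total V → ℝ) (z : ℂ) :
    D.winding (r + s) z = D.winding r z + D.winding s z := by
  simp [winding, add_mul, Finset.sum_add_distrib]

theorem winding_smul [Fintype (Quiver.Total V)] (c : ℝ) (r : Quiver.Total V → ℝ) (z : ℂ) :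
    D.winding (c • r) z = c * D.winding r z := by
  simp [winding, Finset.mul_sum, mul_assoc]

theorem exp_logIncrement_arc (a : Quiver.Total V) {z : ℂ}
    (hz : ∀ s ∈ Set.Icc (0 : ℝ) 1, D.arc a s ≠ z) :
    Complex.exp (logIncrement (fun s => D.arc a s - z)) =
      (D.point a.right - z) / (D.point a.left - z) := by
  rw [exp_logIncrement (f := fun s => D.arc a s - z) ((D.isSimpleArc a).continuousOn.sub continuousOn_const)
    (fun s hs => sub_ne_zero.2 (hz s hs)), D.arc_zero, D.arc_one]

variable [Finite V] [Fintype (Quiver.Total V)]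

/-- The winding number of a flow is locally constant off the drawing. -/
theorem eventually_winding_eq {r : Quiver.Total V → ℝ} (hr : r ∈ flowSpace V) {z : ℂ}
    (hz : z ∈ D.carrierᶜ) : ∀ᶠ z' in nhds z, D.winding r z' = D.winding r z := by
  obtain ⟨d, hd, hball⟩ := Metric.isOpen_iff.1 D.isCompact_carrier.isClosed.isOpen_compl z hz
  filter_upwards [Metric.ball_mem_nhds z hd] with z' hz'
  have hnorm : ∀ p ∈ D.carrier, ‖z - z'‖ < ‖p - z‖ := by
    intro p hp
    by_contra! h
    refine hball (a := p) ?_ hp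
    rw [Metric.mem_ball, dist_eq_norm]
    rw [Metric.mem_ball, dist_comm, dist_eq_norm] at hz'
    exact h.trans_lt hz'
  have h1 : ∀ a, logIncrement (fun s => D.arc a s - z') = logIncrement (fun s => D.arc a s - z) +
      (Complex.log (1 + (z - z') / (D.point a.right - z)) -
        Complex.log (1 + (z - z') / (D.point a.left - z))) := by
    intro a
    rw [← D.arc_zero, ← D.arc_one, ← logIncrement_add_const (f := fun s => D.arc a s - z)
      ((D.isSimpleArc a).continuousOn.sub continuousOn_const)
      (fun s hs => hnorm _ (D.arc_mem_carrier a hs))]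
    simp
  simp only [winding_eq_im, h1, smul_add, Finset.sum_add_distrib]
  rw [sum_smul_sub_eq_zero hr (fun v => Complex.log (1 + (z - z') / (D.point v - z))), add_zero]

/-- The winding number of a flow vanishes far away. -/
theorem exists_winding_eq_zero {r : Quiver.Total V → ℝ} (hr : r ∈ flowSpace V) :
    ∃ R : ℝ, ∀ z : ℂ, R < ‖z‖ → D.winding r z = 0 := by
  obtain ⟨R, hR⟩ := D.isCompact_carrier.isBounded.exists_norm_le
  refine ⟨R, fun z hz => ?_⟩
  have hnorm : ∀ p ∈ D.carrier, ‖p‖ < ‖-z‖ := fun p hp => by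
    rw [norm_neg]; exact (hR p hp).trans_lt hz
  have h1 : ∀ a, logIncrement (fun s => D.arc a s - z) =
      Complex.log (1 + D.point a.right / (-z)) - Complex.log (1 + D.point a.left / (-z)) := by
    intro a
    have hs : ∀ s ∈ Set.Icc (0 : ℝ) 1, 1 + D.arc a s / (-z) ∈ Complex.slitPlane := fun s hs =>
      one_add_div_mem_slitPlane (hnorm _ (D.arc_mem_carrier a hs))
    have hz0 : -z ≠ 0 := norm_pos_iff.1
      ((norm_nonneg _).trans_lt (hnorm _ (D.point_mem_carrier a.left)))
    have : IsLogOn (fun s => Complex.log (1 + D.arc a s / (-z)) + Complex.log (-z))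
        (fun s => D.arc a s - z) (Set.Icc 0 1) :=
      ⟨((continuousOn_const.add ((D.isSimpleArc a).continuousOn.div_const _)).clog hs).add
        continuousOn_const, fun s hs' => by
          rw [Complex.exp_add, Complex.exp_log hz0,
            Complex.exp_log (Complex.slitPlane_ne_zero (hs s hs'))]
          have := neg_ne_zero.1 hz0
          field_simp
          ring⟩
    rw [this.logIncrement_eq, D.arc_zero, D.arc_one]
    ring
  simp only [winding_eq_im, h1]
  rw [sum_smul_sub_eq_zero hr (fun v => Complex.log (1 + D.point v / (-z)))]
  simp

/-- In `∑ r_a Δ_a = ∑ r_a (λ_{target} - λ_{source} + 2πi k_a)` the logarithms `λ` of the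
vertices cancel. -/
theorem exists_int_sum_logIncrement_eq {z : ℂ} (hz : z ∈ D.carrierᶜ) : ∃ k : Quiver.Total V → ℤ,
    ∀ r ∈ flowSpace V, ∑ a, r a • logIncrement (fun s => D.arc a s - z) =
      (∑ a, r a * k a : ℝ) * (2 * Real.pi * Complex.I) := by
  have h1 : ∀ a, ∃ k : ℤ, logIncrement (fun s => D.arc a s - z) =
      (Complex.log (D.point a.right - z) - Complex.log (D.point a.left - z)) +
        k * (2 * Real.pi * Complex.I) := by
    intro a
    rw [← Complex.exp_eq_exp_iff_exists_int, D.exp_logIncrement_arc a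
      (fun s hs h => hz (by rw [← h]; exact D.arc_mem_carrier a hs)), Complex.exp_sub]
    have h2 : ∀ v, D.point v - z ≠ 0 := fun v h => hz (sub_eq_zero.1 h ▸ D.point_mem_carrier v)
    rw [Complex.exp_log (h2 _), Complex.exp_log (h2 _)]
  choose k hk using h1
  refine ⟨k, fun r hr => ?_⟩
  simp only [hk, smul_add, Finset.sum_add_distrib]
  rw [sum_smul_sub_eq_zero hr (fun v => Complex.log (D.point v - z)), zero_add,
    Complex.ofReal_sum, Finset.sum_mul]
  refine Finset.sum_congr rfl fun a _ => ?_
  rw [Complex.real_smul]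
  push_cast
  ring

theorem exists_int_winding_eq {z : ℂ} (hz : z ∈ D.carrierᶜ) : ∃ k : Quiver.Total V → ℤ,
    ∀ r ∈ flowSpace V, D.winding r z = ∑ a, r a * k a := by
  obtain ⟨k, hk⟩ := D.exists_int_sum_logIncrement_eq hz
  refine ⟨k, fun r hr => ?_⟩
  rw [winding_eq_im, hk r hr, Complex.im_ofReal_mul]
  simp

theorem sum_logIncrement_eq_winding {r : Quiver.Total V → ℝ} (hr : r ∈ flowSpace V) {z : ℂ}
    (hz : z ∈ D.carrierᶜ) : ∑ a, r a • logIncrement (fun s => D.arc a s - z) =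
      D.winding r z * (2 * Real.pi * Complex.I) := by
  obtain ⟨k, hk⟩ := D.exists_int_sum_logIncrement_eq hz
  rw [winding_eq_im, hk r hr, Complex.im_ofReal_mul]
  simp

theorem winding_mem_realIntegers {r : Quiver.Total V → ℝ} (hr : r ∈ flowSpace V)
    (hint : ∀ a, r a ∈ realIntegers) {z : ℂ} (hz : z ∈ D.carrierᶜ) :
    D.winding r z ∈ realIntegers := by
  obtain ⟨k, hk⟩ := D.exists_int_winding_eq hz
  rw [hk r hr]
  refine AddSubgroup.sum_mem _ fun a _ => ?_
  obtain ⟨n, hn⟩ := hint a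
  exact ⟨n * k a, by rw [← hn]; simp⟩

/-! ### The jump of the winding number across an arrow -/

/-- Let `E b t` be the logarithmic increment of the arc `b` as seen from the point with parameter
`t` on the arc `a`, where for `b = a` the two chord logarithms replace the increment, which is
undefined. Every `E b` is a continuous logarithm of a quotient of differences to vertices, so
their combinations with the values of a flow are independent of `t`. -/
theorem exists_logIncrement_arc_eq (a : Quiver.Total V) {Λ : ℝ × ℝ → ℂ}
    (hΛ : IsLogOn Λ (fun p => D.arc a p.2 - D.arc a p.1) chordDomain) :
    ∃ E : Quiver.Total V → ℝ → ℂ, (∀ t, E a t = Λ (t, 1) - Λ (0, t)) ∧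
      (∀ b, b ≠ a → ∀ t, E b t = logIncrement (fun s => D.arc b s - D.arc a t)) ∧
      ∀ r ∈ flowSpace V, ∀ t ∈ Set.Ioo (0 : ℝ) 1, ∀ t' ∈ Set.Ioo (0 : ℝ) 1,
        ∑ b, r b • E b t = ∑ b, r b • E b t' := by
  classical
  have harc : ContinuousOn (D.arc a) (Set.Ioo 0 1) :=
    (D.isSimpleArc a).continuousOn.mono Set.Ioo_subset_Icc_self
  have hlog : ∀ v, ∃ g, IsLogOn g (fun t => D.point v - D.arc a t) (Set.Ioo 0 1) := fun v =>
    exists_isLogOn (convex_Ioo 0 1) (continuousOn_const.sub harc)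
      fun t ht => sub_ne_zero.2 (D.arc_ne_point a t ht v).symm
  choose l hl using hlog
  refine ⟨fun b t => if b = a then Λ (t, 1) - Λ (0, t) else
    logIncrement (fun s => D.arc b s - D.arc a t), fun t => by simp, fun b hb t => by simp [hb],
    fun r hr t ht t' ht' => ?_⟩
  set E : Quiver.Total V → ℝ → ℂ := fun b t => if b = a then Λ (t, 1) - Λ (0, t) else
    logIncrement (fun s => D.arc b s - D.arc a t) with hE
  have hEl : ∀ b, E b t - E b t' = (l b.right t - l b.left t) - (l b.right t' - l b.left t') := by
    intro b
    have hq : IsLogOn (fun t => l b.right t - l b.left t)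
        (fun t => (D.point b.right - D.arc a t) / (D.point b.left - D.arc a t)) (Set.Ioo 0 1) :=
      ⟨(hl _).continuousOn.sub (hl _).continuousOn, fun s hs => by
        rw [Complex.exp_sub, (hl _).exp_eq s hs, (hl _).exp_eq s hs]⟩
    by_cases hb : b = a
    · subst hb
      have h1 : IsLogOn (E b)
          (fun t => (D.point b.right - D.arc b t) / (D.arc b t - D.point b.left))
          (Set.Ioo 0 1) := by
        simp only [hE, if_true]
        refine ⟨?_, fun s hs => ?_⟩
        · exact (hΛ.continuousOn.comp (by fun_prop) fun s hs =>
              mem_chordDomain.2 ⟨hs.1.le, hs.2, le_rfl⟩).sub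
            (hΛ.continuousOn.comp (by fun_prop) fun s hs =>
              mem_chordDomain.2 ⟨le_rfl, hs.1, hs.2.le⟩)
        · rw [Complex.exp_sub, hΛ.exp_eq (s, 1) (mem_chordDomain.2 ⟨hs.1.le, hs.2, le_rfl⟩),
            hΛ.exp_eq (0, s) (mem_chordDomain.2 ⟨le_rfl, hs.1, hs.2.le⟩), D.arc_zero, D.arc_one]
      exact h1.sub_eq_sub isPreconnected_Ioo hq (c := -1) (by simp)
        (fun s _ => by rw [← neg_sub (D.point b.left) (D.arc b s), div_neg, neg_one_mul]) ht ht'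
    · have hne : ∀ t ∈ Set.Ioo (0 : ℝ) 1, ∀ s ∈ Set.Icc (0 : ℝ) 1, D.arc b s ≠ D.arc a t := by
        intro t ht s hs h
        rcases hs.1.eq_or_lt with rfl | h0
        · exact D.arc_ne_point a t ht b.left (by rw [← h, D.arc_zero])
        rcases hs.2.eq_or_lt with rfl | h1
        · exact D.arc_ne_point a t ht b.right (by rw [← h, D.arc_one])
        · exact D.arc_ne_arc b a hb s ⟨h0, h1⟩ t ht h
      have h1 : IsLogOn (E b)
          (fun t => (D.point b.right - D.arc a t) / (D.point b.left - D.arc a t))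
          (Set.Ioo 0 1) := by
        simp only [hE, if_neg hb]
        refine ⟨fun s hs => ?_, fun s hs => D.exp_logIncrement_arc b (hne s hs)⟩
        exact ContinuousAt.comp_continuousWithinAt
          (g := fun z => logIncrement (fun s => D.arc b s - z))
          (continuousAt_logIncrement_sub (D.isSimpleArc b).continuousOn (hne s hs)) (harc s hs)
      exact h1.sub_eq_sub isPreconnected_Ioo hq (c := 1) (by simp) (fun s _ => by ring) ht ht'
  rw [← sub_eq_zero, ← Finset.sum_sub_distrib]
  simp only [← smul_sub, hEl]
  rw [← sum_smul_sub_eq_zero hr (fun v => l v t - l v t')]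
  refine Finset.sum_congr rfl fun b _ => ?_
  congr 1
  ring

/-- The boundary values of the winding number of a flow on the two sides of an arc differ by the
value of the flow; each of them is the same at all parameters. -/
theorem exists_tendsto_winding {r : Quiver.Total V → ℝ} (hr : r ∈ flowSpace V)
    (a : Quiver.Total V) : ∃ C : ℝ, ∀ t ∈ Set.Ioo (0 : ℝ) 1, deriv (D.arc a) t ≠ 0 →
      ∀ σ : ℝ, σ = 1 ∨ σ = -1 → Filter.Tendsto
        (fun ε : ℝ => D.winding r (D.arc a t + σ * (ε * (Complex.I * deriv (D.arc a) t))))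
        (nhdsWithin 0 (Set.Ioi 0)) (nhds (C + σ * r a / 2)) := by
  classical
  obtain ⟨Λ, hΛ⟩ := exists_isLogOn_chord (D.isSimpleArc a).continuousOn (D.isSimpleArc a).injOn
  obtain ⟨E, hEa, hEb, hE⟩ := D.exists_logIncrement_arc_eq a hΛ
  refine ⟨(∑ b, r b • E b (1 / 2)).im / (2 * Real.pi), fun t ht hd σ hσ => ?_⟩
  have hda : HasDerivAt (D.arc a) (deriv (D.arc a) t) t :=
    (differentiableAt_of_deriv_ne_zero hd).hasDerivAt
  set w : ℝ → ℂ := fun ε => D.arc a t + σ * (ε * (Complex.I * deriv (D.arc a) t)) with hw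
  have hw0 : w 0 = D.arc a t := by simp [hw]
  have hwc : Filter.Tendsto w (nhdsWithin 0 (Set.Ioi 0)) (nhds (D.arc a t)) := by
    have : Continuous w := by fun_prop
    exact (hw0 ▸ this.tendsto 0).mono_left nhdsWithin_le_nhds
  have hlim : ∀ b, Filter.Tendsto (fun ε => r b • logIncrement (fun s => D.arc b s - w ε))
      (nhdsWithin 0 (Set.Ioi 0))
      (nhds (r b • (E b t + if b = a then σ * Real.pi * Complex.I else 0))) := by
    intro b
    refine Filter.Tendsto.const_smul ?_ _
    by_cases hb : b = a
    · subst hb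
      rw [if_pos rfl, hEa]
      exact tendsto_logIncrement_normal (D.isSimpleArc b).continuousOn (D.isSimpleArc b).injOn ht
        hda hd hΛ hσ
    · rw [if_neg hb, hEb b hb, add_zero]
      refine (ContinuousAt.tendsto (f := fun z => logIncrement (fun s => D.arc b s - z))
        (continuousAt_logIncrement_sub (D.isSimpleArc b).continuousOn ?_)).comp hwc
      intro s hs h
      rcases hs.1.eq_or_lt with rfl | h0
      · exact D.arc_ne_point a t ht b.left (by rw [← h, D.arc_zero])
      rcases hs.2.eq_or_lt with rfl | h1
      · exact D.arc_ne_point a t ht b.right (by rw [← h, D.arc_one])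
      · exact D.arc_ne_arc b a hb s ⟨h0, h1⟩ t ht h
  have hsum := tendsto_finsetSum Finset.univ fun b _ => hlim b
  have := ((Complex.continuous_im.tendsto _).comp hsum).div_const (2 * Real.pi)
  have hpi := Real.pi_ne_zero
  convert this using 2
  · exact D.winding_eq_im r _
  · simp only [smul_add, Finset.sum_add_distrib, smul_ite, smul_zero, Finset.sum_ite_eq',
      Finset.mem_univ, if_true]
    rw [hE r hr t ht (1 / 2) (by norm_num)]
    simp
    field_simp

end PlaneEmbedding

/-! ### The regions of the drawing -/

theorem IsSimpleArc.exists_deriv_ne_zero {γ : ℝ → ℂ} (h : IsSimpleArc γ) :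
    ∃ t ∈ Set.Ioo (0 : ℝ) 1, deriv γ t ≠ 0 := by
  obtain ⟨S, hS⟩ := h.piecewise
  obtain ⟨x, hx, hxS⟩ := ((Set.Ioo_infinite (zero_lt_one' ℝ)).sdiff S.finite_toSet).nonempty
  obtain ⟨d, hd, hball⟩ := Metric.isOpen_iff.1
    (isOpen_Ioo.sdiff S.finite_toSet.isClosed) x ⟨hx, hxS⟩
  have hsub : Set.Icc (x - d / 2) (x + d / 2) ⊆ Set.Ioo 0 1 \ S := by
    refine subset_trans ?_ hball
    rw [Real.ball_eq_Ioo]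
    exact Set.Icc_subset_Ioo (by linarith) (by linarith)
  have hl := hsub (Set.left_mem_Icc.2 (show x - d / 2 ≤ x + d / 2 by linarith))
  have hr := hsub (Set.right_mem_Icc.2 (show x - d / 2 ≤ x + d / 2 by linarith))
  refine ⟨x, hx, ?_⟩
  have := (hS (x - d / 2) (x + d / 2) hl.1.1.le (by linarith) hr.1.2.le
    (fun y hy hy' => (hsub (Set.Ioo_subset_Icc_self hy')).2 hy)).2 x ⟨by linarith, by linarith⟩
  rwa [derivWithin_of_mem_nhds (Icc_mem_nhds (by linarith) (by linarith))] at this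

namespace PlaneEmbedding

variable {V : Type*} [Quiver V] {D : PlaneEmbedding V}

theorem Region.nonempty (U : D.Region) : U.1.Nonempty := by
  obtain ⟨p, hp, h⟩ := U.2
  exact ⟨p, h ▸ mem_connectedComponentIn hp⟩

theorem Region.subset_compl (U : D.Region) : U.1 ⊆ D.carrierᶜ := by
  obtain ⟨p, hp, h⟩ := U.2
  rw [h]
  exact connectedComponentIn_subset _ _

theorem Region.isPreconnected (U : D.Region) : IsPreconnected U.1 := by
  obtain ⟨p, hp, h⟩ := U.2
  rw [h]
  exact isPreconnected_connectedComponentIn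

theorem Region.eq_connectedComponentIn (U : D.Region) {z : ℂ} (hz : z ∈ U.1) :
    U.1 = connectedComponentIn D.carrierᶜ z := by
  obtain ⟨p, hp, h⟩ := U.2
  rw [h] at hz ⊢
  exact connectedComponentIn_eq hz

theorem Region.eq_of_mem {U U' : D.Region} {z : ℂ} (hz : z ∈ U.1) (hz' : z ∈ U'.1) : U = U' :=
  Subtype.ext (by rw [U.eq_connectedComponentIn hz, U'.eq_connectedComponentIn hz'])

/-- A point of the region. -/
noncomputable def Region.somePoint (U : D.Region) : ℂ := U.nonempty.some

theorem Region.somePoint_mem (U : D.Region) : U.somePoint ∈ U.1 := U.nonempty.some_mem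

theorem BoundedRegion.eq_of_somePoint_mem {U W : D.BoundedRegion} (h : U.1.somePoint ∈ W.1.1) :
    U = W :=
  Subtype.ext (Region.eq_of_mem U.1.somePoint_mem h)

variable [Finite V] [Fintype (Quiver.Total V)]

theorem Region.isOpen (U : D.Region) : IsOpen U.1 := by
  obtain ⟨p, hp, h⟩ := U.2
  rw [h]
  exact D.isCompact_carrier.isClosed.isOpen_compl.connectedComponentIn

theorem Region.frontier_subset (U : D.Region) : frontier U.1 ⊆ D.carrier := by
  intro z hz
  by_contra hzc
  let W : D.Region := ⟨_, z, hzc, rfl⟩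
  have hzW : z ∈ W.1 := mem_connectedComponentIn hzc
  obtain ⟨x, hxW, hxU⟩ := mem_closure_iff.1 hz.1 W.1 W.isOpen hzW
  rw [Region.eq_of_mem hxW hxU] at hzW
  rw [U.isOpen.frontier_eq] at hz
  exact hz.2 hzW

theorem Region.winding_eq (U : D.Region) {r : Quiver.Total V → ℝ} (hr : r ∈ flowSpace V) {z : ℂ}
    (hz : z ∈ U.1) : D.winding r z = D.winding r U.somePoint := by
  have hlc : IsLocallyConstant (fun z : U.1 => D.winding r z) := by
    rw [IsLocallyConstant.iff_eventually_eq]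
    intro x
    exact continuousAt_subtype_val.eventually (D.eventually_winding_eq hr (U.subset_compl x.2))
  have := Subtype.preconnectedSpace U.isPreconnected
  exact hlc.apply_eq_of_preconnectedSpace ⟨z, hz⟩ ⟨_, U.somePoint_mem⟩

theorem Region.winding_eq_zero (U : D.Region) (hU : ¬ Bornology.IsBounded U.1)
    {r : Quiver.Total V → ℝ} (hr : r ∈ flowSpace V) : D.winding r U.somePoint = 0 := by
  obtain ⟨R, hR⟩ := D.exists_winding_eq_zero hr
  by_contra hne
  refine hU ((Metric.isBounded_closedBall (x := (0 : ℂ)) (r := R)).subset fun z hz => ?_)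
  rw [mem_closedBall_zero_iff]
  by_contra! h
  exact hne (U.winding_eq hr hz ▸ hR z h)

/-- The winding number of a flow drops by its value on an arrow from the left to the right. -/
theorem winding_left_sub_right {r : Quiver.Total V → ℝ} (hr : r ∈ flowSpace V)
    {a : Quiver.Total V} {L R : D.Region} (hL : D.IsLeftRegion a L) (hR : D.IsRightRegion a R) :
    D.winding r L.somePoint - D.winding r R.somePoint = r a := by
  obtain ⟨C, hC⟩ := D.exists_tendsto_winding hr a
  obtain ⟨t, ht, hd, δ, hδ, h⟩ := hL
  obtain ⟨t', ht', hd', δ', hδ', h'⟩ := hR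
  have hev : ∀ δ > (0 : ℝ), Set.Ioo 0 δ ∈ nhdsWithin (0 : ℝ) (Set.Ioi 0) := fun δ hδ =>
    Ioo_mem_nhdsGT hδ
  have e1 : D.winding r L.somePoint = C + r a / 2 := by
    refine tendsto_nhds_unique (Filter.Tendsto.congr' ?_ tendsto_const_nhds)
      (by simpa using hC t ht hd 1 (Or.inl rfl))
    filter_upwards [hev δ hδ] with ε hε
    exact (L.winding_eq hr (h ε hε)).symm
  have e2 : D.winding r R.somePoint = C - r a / 2 := by
    refine tendsto_nhds_unique (Filter.Tendsto.congr' ?_ tendsto_const_nhds)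
      (by simpa [neg_div, ← sub_eq_add_neg] using hC t' ht' hd' (-1) (Or.inr rfl))
    filter_upwards [hev δ' hδ'] with ε hε
    exact (R.winding_eq hr (h' ε hε)).symm
  rw [e1, e2]
  ring

theorem eventually_normal_notMem_carrier {a : Quiver.Total V} {t : ℝ}
    (ht : t ∈ Set.Ioo (0 : ℝ) 1) (hd : deriv (D.arc a) t ≠ 0) {σ : ℝ} (hσ : σ ≠ 0) :
    ∀ᶠ ε : ℝ in nhdsWithin 0 (Set.Ioi 0),
      D.arc a t + σ * (ε * (Complex.I * deriv (D.arc a) t)) ∉ D.carrier := by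
  set d := deriv (D.arc a) t with hdd
  have hda : HasDerivAt (D.arc a) d t := (differentiableAt_of_deriv_ne_zero hd).hasDerivAt
  have hd0 : 0 < ‖d‖ := norm_pos_iff.2 hd
  obtain ⟨δ, hδ, hball⟩ := Metric.eventually_nhds_iff_ball.1
    ((hasDerivAt_iff_isLittleO.1 hda).def (c := ‖d‖ / 2) (by positivity))
  set K : Set ℂ := Set.range D.point ∪ ((⋃ b : {b // b ≠ a}, D.arc b '' Set.Icc 0 1) ∪
    D.arc a '' (Set.Icc 0 1 \ Metric.ball t δ)) with hK
  have hKc : IsClosed K := by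
    refine ((Set.finite_range _).isCompact.union (IsCompact.union (isCompact_iUnion fun b : {b // b ≠ a} =>
      isCompact_Icc.image_of_continuousOn (D.isSimpleArc b).continuousOn) ?_)).isClosed
    exact (isCompact_Icc.diff Metric.isOpen_ball).image_of_continuousOn
      ((D.isSimpleArc a).continuousOn.mono Set.sdiff_subset)
  have hKt : D.arc a t ∈ Kᶜ := by
    rintro (⟨v, hv⟩ | h | ⟨s, ⟨hs, hs'⟩, h⟩)
    · exact D.arc_ne_point a t ht v hv.symm
    · obtain ⟨⟨b, hb⟩, s, hs, h⟩ := Set.mem_iUnion.1 h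
      rcases hs.1.eq_or_lt with rfl | h0
      · exact D.arc_ne_point a t ht b.left (by rw [← h, D.arc_zero])
      rcases hs.2.eq_or_lt with rfl | h1
      · exact D.arc_ne_point a t ht b.right (by rw [← h, D.arc_one])
      · exact D.arc_ne_arc b a hb s ⟨h0, h1⟩ t ht h
    · rw [(D.isSimpleArc a).injOn hs ⟨ht.1.le, ht.2.le⟩ h] at hs'
      exact hs' (Metric.mem_ball_self hδ)
  have hcont : Continuous fun ε : ℝ => D.arc a t + σ * (ε * (Complex.I * d)) := by fun_prop
  have hev := hcont.continuousAt.eventually_mem (x := 0)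
    (hKc.isOpen_compl.mem_nhds (by simpa using hKt))
  filter_upwards [hev.filter_mono nhdsWithin_le_nhds, self_mem_nhdsWithin] with ε hε hε0
  rw [Set.mem_Ioi] at hε0
  rintro (h | h)
  · exact hε (Or.inl h)
  obtain ⟨b, s, hs, h⟩ := Set.mem_iUnion.1 h
  by_cases hb : b = a
  · subst hb
    by_cases hst : s ∈ Metric.ball t δ
    · have h1 := hball s hst
      rw [h] at h1
      -- the real part of `i σ ε - (s - t)` is `-(s - t)`
      have h2 : D.arc b t + σ * (ε * (Complex.I * d)) - D.arc b t - (s - t) • d =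
          d * (σ * ε * Complex.I - ((s - t : ℝ) : ℂ)) := by
        rw [Complex.real_smul]
        ring
      rw [h2, norm_mul, Real.norm_eq_abs] at h1
      have h3 : |s - t| ≤ ‖(σ * ε * Complex.I - ((s - t : ℝ) : ℂ))‖ := by
        have := Complex.abs_re_le_norm (σ * ε * Complex.I - ((s - t : ℝ) : ℂ))
        simpa [abs_sub_comm] using this
      have h4 : ‖d‖ * |s - t| ≤ ‖d‖ / 2 * |s - t| :=
        (mul_le_mul_of_nonneg_left h3 hd0.le).trans h1
      have h5 : |s - t| = 0 := by
        have := abs_nonneg (s - t)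
        nlinarith
      have h6 : s = t := sub_eq_zero.1 (abs_eq_zero.1 h5)
      rw [h6] at h
      have h7 : σ * (ε * (Complex.I * d)) = 0 := by linear_combination -h
      simp [hσ, hε0.ne', hd] at h7
    · exact hε (Or.inr (Or.inr ⟨s, ⟨hs, hst⟩, h⟩))
  · exact hε (Or.inr (Or.inl (Set.mem_iUnion.2 ⟨⟨b, hb⟩, s, hs, h⟩)))

theorem exists_region_normal {a : Quiver.Total V} {t : ℝ}
    (ht : t ∈ Set.Ioo (0 : ℝ) 1) (hd : deriv (D.arc a) t ≠ 0) {σ : ℝ} (hσ : σ ≠ 0) :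
    ∃ U : D.Region, ∃ δ > (0 : ℝ), ∀ ε ∈ Set.Ioo 0 δ,
      D.arc a t + σ * (ε * (Complex.I * deriv (D.arc a) t)) ∈ U.1 := by
  obtain ⟨δ, hδ, h⟩ := mem_nhdsGT_iff_exists_Ioo_subset.1
    (eventually_normal_notMem_carrier ht hd hσ)
  rw [Set.mem_Ioi] at hδ
  have hmid : δ / 2 ∈ Set.Ioo 0 δ := ⟨by linarith, by linarith⟩
  refine ⟨⟨_, _, h hmid, rfl⟩, δ, hδ, fun ε hε => ?_⟩
  have hcont : Continuous fun ε : ℝ =>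
    D.arc a t + σ * (ε * (Complex.I * deriv (D.arc a) t)) := by fun_prop
  refine (isPreconnected_Ioo.image _ hcont.continuousOn).subset_connectedComponentIn
    (Set.mem_image_of_mem _ hmid) ?_ (Set.mem_image_of_mem _ hε)
  rintro _ ⟨x, hx, rfl⟩
  exact h hx

theorem exists_isLeftRegion (D : PlaneEmbedding V) (a : Quiver.Total V) :
    ∃ U, D.IsLeftRegion a U := by
  obtain ⟨t, ht, hd⟩ := (D.isSimpleArc a).exists_deriv_ne_zero
  obtain ⟨U, δ, hδ, h⟩ := exists_region_normal ht hd one_ne_zero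
  exact ⟨U, t, ht, hd, δ, hδ, fun ε hε => by simpa using h ε hε⟩

theorem exists_isRightRegion (D : PlaneEmbedding V) (a : Quiver.Total V) :
    ∃ U, D.IsRightRegion a U := by
  obtain ⟨t, ht, hd⟩ := (D.isSimpleArc a).exists_deriv_ne_zero
  obtain ⟨U, δ, hδ, h⟩ := exists_region_normal ht hd (neg_ne_zero.2 one_ne_zero)
  exact ⟨U, t, ht, hd, δ, hδ, fun ε hε => by simpa [sub_eq_add_neg] using h ε hε⟩

end PlaneEmbedding

/-! ### Potentials on a connected quiver -/

theorem Quiver.IsConnected.eq_of_arrow {V X : Type*} [Quiver V] (h : Quiver.IsConnected V)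
    {f : V → X} (hf : ∀ a : Quiver.Total V, f a.left = f a.right) (v w : V) : f v = f w := by
  obtain ⟨p⟩ := h.2 v w
  induction p with
  | nil => rfl
  | cons p e ih =>
    refine ih.trans ?_
    rcases e with e | e
    · exact hf ⟨_, _, e⟩
    · exact (hf ⟨_, _, e⟩).symm

/-- On a connected quiver, any two vertices are the ends of an integral chain. -/
theorem Quiver.IsConnected.exists_chain {V : Type*} [Quiver V] [Fintype (Quiver.Total V)]
    [DecidableEq V] (h : Quiver.IsConnected V) (v w : V) : ∃ n : Quiver.Total V → ℝ,
      (∀ a, n a ∈ realIntegers) ∧ ∀ q : V, ∑ a with a.right = q, n a - ∑ a with a.left = q, n a =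
        (if w = q then 1 else 0) - (if v = q then 1 else 0) := by
  classical
  have key := h.eq_of_arrow (f := fun w => ∃ n : Quiver.Total V → ℝ,
      (∀ a, n a ∈ realIntegers) ∧ ∀ q : V, ∑ a with a.right = q, n a - ∑ a with a.left = q, n a =
        (if w = q then 1 else 0) - (if v = q then 1 else 0)) (fun a => by
    have hs : ∀ b, (Pi.single a 1 : Quiver.Total V → ℝ) b ∈ realIntegers := fun b => by
      rw [Pi.single_apply]
      split_ifs
      · exact ⟨1, by simp⟩
      · exact realIntegers.zero_mem
    refine propext ⟨?_, ?_⟩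
    · rintro ⟨n, hn, hq⟩
      refine ⟨n + Pi.single a 1, fun b => realIntegers.add_mem (hn b) (hs b), fun q => ?_⟩
      simp only [Pi.add_apply, Finset.sum_add_distrib, Finset.sum_pi_single', Finset.mem_filter,
        Finset.mem_univ, true_and]
      linear_combination hq q
    · rintro ⟨n, hn, hq⟩
      refine ⟨n - Pi.single a 1, fun b => realIntegers.sub_mem (hn b) (hs b), fun q => ?_⟩
      simp only [Pi.sub_apply, Finset.sum_sub_distrib, Finset.sum_pi_single', Finset.mem_filter,
        Finset.mem_univ, true_and]
      linear_combination hq q) v w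
  rw [← key]
  exact ⟨0, fun a => realIntegers.zero_mem, fun q => by simp⟩

/-- A function on the arrows that is orthogonal to the integral flows has a potential. -/
theorem Quiver.IsConnected.exists_potential {V M : Type*} [Quiver V] [Fintype (Quiver.Total V)]
    [AddCommGroup M] [Module ℝ M] (h : Quiver.IsConnected V) {δ : Quiver.Total V → M}
    (hδ : ∀ r ∈ flowSpace V, (∀ a, r a ∈ realIntegers) → ∑ a, r a • δ a = 0) (v₀ : V) (c₀ : M) :
    ∃ c : V → M, c v₀ = c₀ ∧ ∀ a : Quiver.Total V, c a.right = c a.left + δ a := by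
  classical
  choose n hn hq using fun w => h.exists_chain v₀ w
  refine ⟨fun w => c₀ + ∑ a, n w a • δ a, ?_, fun a => ?_⟩
  · beta_reduce
    rw [hδ (n v₀) (mem_flowSpace.2 fun q => by
      have := hq v₀ q
      rwa [sub_self, sub_eq_zero] at this) (hn v₀), add_zero]
  · have h1 := hδ (n a.left + Pi.single a 1 - n a.right) (mem_flowSpace.2 fun q => by
        have h1 := hq a.left q
        have h2 := hq a.right q
        simp only [Pi.add_apply, Pi.sub_apply, Finset.sum_sub_distrib, Finset.sum_add_distrib,
          Finset.sum_pi_single', Finset.mem_filter, Finset.mem_univ, true_and]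
        linear_combination h1 - h2) (fun b => by
        refine realIntegers.sub_mem (realIntegers.add_mem (hn _ b) ?_) (hn _ b)
        rw [Pi.single_apply]
        split_ifs
        · exact ⟨1, by simp⟩
        · exact realIntegers.zero_mem)
    simp only [Pi.add_apply, Pi.sub_apply, sub_smul, add_smul, Finset.sum_sub_distrib,
      Finset.sum_add_distrib, Pi.single_apply, ite_smul, one_smul, zero_smul, Finset.sum_ite_eq',
      Finset.mem_univ, if_true] at h1
    beta_reduce
    rw [add_assoc, ← sub_eq_zero.1 h1]

/-! ### Bounded regions carry independent winding numbers -/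

/-- A power `(w - z₀) ^ n` with `n ≠ 0` has no logarithm on a circle around `z₀` that extends
continuously to the plane. -/
theorem eq_zero_of_exp_eq_zpow {κ : ℂ → ℂ} (hκ : Continuous κ) {z₀ : ℂ} {R : ℝ} (hR : 0 < R)
    {n : ℤ} (h : ∀ w, ‖w - z₀‖ = R → Complex.exp (κ w) = (w - z₀) ^ n) : n = 0 := by
  set c : ℝ → ℂ := fun θ => R * Complex.exp (2 * Real.pi * Complex.I * θ) with hc
  have hcc : Continuous c := by fun_prop
  have hR' : (R : ℂ) ≠ 0 := by exact_mod_cast hR.ne'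
  have hnorm : ∀ θ, ‖c θ‖ = R := fun θ => by
    have h1 : (2 * Real.pi * Complex.I * θ : ℂ) = ((2 * Real.pi * θ : ℝ) : ℂ) * Complex.I := by
      push_cast; ring
    simp only [hc]
    rw [h1, norm_mul, Complex.norm_exp_ofReal_mul_I, Complex.norm_real, Real.norm_of_nonneg hR.le,
      mul_one]
  have l1 : IsLogOn (fun θ => κ (z₀ + c θ)) (fun θ => c θ ^ n) (Set.Icc 0 1) :=
    ⟨(hκ.comp (by fun_prop)).continuousOn, fun θ _ => by rw [h _ (by simp [hnorm])]; simp⟩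
  have l2 : IsLogOn (fun θ : ℝ => (n : ℂ) * (Complex.log R + 2 * Real.pi * Complex.I * θ))
      (fun θ => c θ ^ n) (Set.Icc 0 1) :=
    ⟨by fun_prop, fun θ _ => by
      rw [Complex.exp_int_mul, Complex.exp_add, Complex.exp_log hR']⟩
  have := l1.sub_eq_sub isPreconnected_Icc l2 one_ne_zero (by simp)
    (x := 1) (y := 0) (by simp) (by simp)
  have h0 : c 1 = c 0 := by simp [hc, Complex.exp_two_pi_mul_I]
  rw [h0, sub_self] at this
  have h2 : (n : ℂ) * (2 * Real.pi * Complex.I) = 0 := by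
    rw [this]
    push_cast
    ring
  simpa [Real.pi_ne_zero] using h2

namespace PlaneEmbedding

variable {V : Type*} [Quiver V] (D : PlaneEmbedding V) [Finite V] [Fintype (Quiver.Total V)]

/-- Continuous functions on the arcs that agree at the vertices glue to a continuous function on
the drawing. -/
theorem exists_continuousOn_carrier {c : V → ℂ} {H : Quiver.Total V → ℝ → ℂ}
    (hH : ∀ a, ContinuousOn (H a) (Set.Icc 0 1)) (h0 : ∀ a, H a 0 = c a.left)
    (h1 : ∀ a, H a 1 = c a.right) : ∃ F : ℂ → ℂ, ContinuousOn F D.carrier ∧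
      (∀ v, F (D.point v) = c v) ∧ ∀ a, ∀ s ∈ Set.Icc (0 : ℝ) 1, F (D.arc a s) = H a s := by
  classical
  have hex : ∀ w, ∃ y, (∀ v, w = D.point v → y = c v) ∧
      ∀ a, ∀ s ∈ Set.Icc (0 : ℝ) 1, w = D.arc a s → y = H a s := by
    intro w
    by_cases hv : ∃ v, w = D.point v
    · obtain ⟨v, rfl⟩ := hv
      refine ⟨c v, fun v' hv' => by rw [D.point_injective hv'], fun a s hs h => ?_⟩
      rcases hs.1.eq_or_lt with rfl | hs0
      · rw [D.arc_zero] at h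
        rw [h0, D.point_injective h]
      rcases hs.2.eq_or_lt with rfl | hs1
      · rw [D.arc_one] at h
        rw [h1, D.point_injective h]
      · exact absurd h.symm (D.arc_ne_point a s ⟨hs0, hs1⟩ v)
    · have hoo : ∀ a, ∀ s ∈ Set.Icc (0 : ℝ) 1, w = D.arc a s → s ∈ Set.Ioo (0 : ℝ) 1 := by
        intro a s hs h
        refine ⟨hs.1.lt_of_ne ?_, hs.2.lt_of_ne ?_⟩
        · rintro rfl
          exact hv ⟨_, h.trans (D.arc_zero a)⟩
        · rintro rfl
          exact hv ⟨_, h.trans (D.arc_one a)⟩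
      by_cases ha : ∃ a, ∃ s ∈ Set.Icc (0 : ℝ) 1, w = D.arc a s
      · obtain ⟨a, s, hs, rfl⟩ := ha
        refine ⟨H a s, fun v h => absurd ⟨v, h⟩ hv, fun a' s' hs' h => ?_⟩
        by_cases haa : a = a'
        · subst haa
          rw [(D.isSimpleArc a).injOn hs hs' h]
        · exact absurd h (D.arc_ne_arc a a' haa s (hoo a s hs rfl) s' (hoo a' s' hs' h))
      · exact ⟨0, fun v h => absurd ⟨v, h⟩ hv, fun a s hs h => absurd ⟨a, s, hs, h⟩ ha⟩
  choose F hFv hFa using hex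
  have hFv' : ∀ v, F (D.point v) = c v := fun v => hFv _ v rfl
  have hFa' : ∀ a, ∀ s ∈ Set.Icc (0 : ℝ) 1, F (D.arc a s) = H a s := fun a s hs => hFa _ a s hs rfl
  refine ⟨F, ?_, hFv', hFa'⟩
  rw [continuousOn_iff_isClosed]
  intro C hC
  refine ⟨F ⁻¹' C ∩ D.carrier, ?_, by rw [Set.inter_assoc, Set.inter_self]⟩
  have hset : F ⁻¹' C ∩ D.carrier = (F ⁻¹' C ∩ Set.range D.point) ∪
      ⋃ a, D.arc a '' (Set.Icc 0 1 ∩ H a ⁻¹' C) := by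
    rw [carrier, Set.inter_union_distrib_left, Set.inter_iUnion]
    congr 1
    refine Set.iUnion_congr fun a => ?_
    ext w
    constructor
    · rintro ⟨hw, s, hs, rfl⟩
      exact ⟨s, ⟨hs, by rwa [Set.mem_preimage, hFa' a s hs] at hw⟩, rfl⟩
    · rintro ⟨s, ⟨hs, hw⟩, rfl⟩
      exact ⟨by rwa [Set.mem_preimage, hFa' a s hs], s, hs, rfl⟩
  rw [hset]
  refine (((Set.finite_range D.point).subset Set.inter_subset_right).isCompact.union
    (isCompact_iUnion fun a => ?_)).isClosed
  have hcl := (hH a).preimage_isClosed_of_isClosed isClosed_Icc hC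
  exact (isCompact_Icc.of_isClosed_subset hcl Set.inter_subset_left).image_of_continuousOn
    ((D.isSimpleArc a).continuousOn.mono Set.inter_subset_left)

/-- If an integral combination of the winding numbers around bounded regions vanishes on all
integral flows, then `∏ (w - z_U) ^ y_U` has a continuous logarithm on the drawing. -/
theorem exists_log_prod_on_carrier (hconn : Quiver.IsConnected V) (s : Finset D.BoundedRegion)
    (y : D.BoundedRegion → ℤ) (hy : ∀ r ∈ flowSpace V, (∀ a, r a ∈ realIntegers) →
      ∑ U ∈ s, y U * D.winding r U.1.somePoint = 0) :
    ∃ F, IsLogOn F (fun w => ∏ U ∈ s, (w - U.1.somePoint) ^ y U) D.carrier := by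
  have hne : ∀ w ∈ D.carrier, ∀ U : D.BoundedRegion, w - U.1.somePoint ≠ 0 := fun w hw U h =>
    U.1.subset_compl U.1.somePoint_mem (sub_eq_zero.1 h ▸ hw)
  set g : ℂ → ℂ := fun w => ∏ U ∈ s, (w - U.1.somePoint) ^ y U with hg
  have hg0 : ∀ w ∈ D.carrier, g w ≠ 0 := fun w hw =>
    Finset.prod_ne_zero_iff.2 fun U _ => zpow_ne_zero _ (hne w hw U)
  have hlog : ∀ (a : Quiver.Total V) (U : D.BoundedRegion),
      ∃ l, IsLogOn l (fun t => D.arc a t - U.1.somePoint) (Set.Icc 0 1) := fun a U =>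
    exists_isLogOn_Icc ((D.isSimpleArc a).continuousOn.sub continuousOn_const)
      fun t ht => hne _ (D.arc_mem_carrier a ht) U
  choose l hl using hlog
  set G : Quiver.Total V → ℝ → ℂ := fun a t => ∑ U ∈ s, (y U : ℂ) * l a U t with hG
  have hGl : ∀ a, IsLogOn (G a) (fun t => g (D.arc a t)) (Set.Icc 0 1) := fun a =>
    ⟨continuousOn_finsetSum s fun U _ => continuousOn_const.mul (hl a U).continuousOn,
      fun t ht => by
        simp only [hG, hg]
        rw [Complex.exp_sum]
        refine Finset.prod_congr rfl fun U _ => ?_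
        rw [Complex.exp_int_mul, (hl a U).exp_eq t ht]⟩
  obtain ⟨v₀⟩ := hconn.1
  obtain ⟨c, hc0, hc⟩ := hconn.exists_potential (δ := fun a => G a 1 - G a 0) (fun r hr hint => by
    have h1 : ∀ a, G a 1 - G a 0 =
        ∑ U ∈ s, (y U : ℂ) * logIncrement (fun t => D.arc a t - U.1.somePoint) := fun a => by
      simp only [hG]
      rw [← Finset.sum_sub_distrib]
      refine Finset.sum_congr rfl fun U _ => ?_
      rw [(hl a U).logIncrement_eq]
      ring
    simp only [h1, Finset.smul_sum]
    rw [Finset.sum_comm]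
    simp only [← mul_smul_comm, ← Finset.mul_sum]
    rw [Finset.sum_congr rfl fun U _ => by
      rw [D.sum_logIncrement_eq_winding hr (U.1.subset_compl U.1.somePoint_mem), ← mul_assoc]]
    rw [← Finset.sum_mul]
    have h2 := congrArg (fun x : ℝ => (x : ℂ)) (hy r hr hint)
    push_cast at h2
    rw [h2, zero_mul]) v₀ (Complex.log (g (D.point v₀)))
  have hexp : ∀ v, Complex.exp (c v) = g (D.point v) := by
    intro v
    have h1 := hconn.eq_of_arrow (f := fun v => Complex.exp (c v) / g (D.point v)) (fun a => by
      have h2 := (hGl a).exp_eq 0 (by simp)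
      have h3 := (hGl a).exp_eq 1 (by simp)
      rw [D.arc_zero] at h2
      rw [D.arc_one] at h3
      have h4 := hg0 _ (D.point_mem_carrier a.left)
      have h5 := hg0 _ (D.point_mem_carrier a.right)
      rw [hc a, Complex.exp_add, Complex.exp_sub, h2, h3]
      field_simp) v v₀
    rw [hc0, Complex.exp_log (hg0 _ (D.point_mem_carrier v₀)),
      div_self (hg0 _ (D.point_mem_carrier v₀))] at h1
    exact (div_eq_one_iff_eq (hg0 _ (D.point_mem_carrier v))).1 h1
  obtain ⟨F, hFc, hFv, hFa⟩ := D.exists_continuousOn_carrier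
    (c := c) (H := fun a t => c a.left + (G a t - G a 0))
    (fun a => continuousOn_const.add ((hGl a).continuousOn.sub continuousOn_const))
    (fun a => by simp) (fun a => (hc a).symm)
  refine ⟨F, hFc, ?_⟩
  rintro w (⟨v, rfl⟩ | hw)
  · rw [hFv, hexp]
  · obtain ⟨a, t, ht, rfl⟩ := Set.mem_iUnion.1 hw
    have h2 := (hGl a).exp_eq 0 (by simp)
    rw [D.arc_zero] at h2
    rw [hFa a t ht, Complex.exp_add, Complex.exp_sub, hexp, (hGl a).exp_eq t ht, h2,
      mul_div_cancel₀ _ (hg0 _ (D.point_mem_carrier a.left))]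

/-- The winding numbers around the bounded regions are linearly independent over `ℤ`. Otherwise
the logarithm `F` of `∏ (w - z_U) ^ y_U` on the drawing, extended to the plane, would produce a
continuous function without zeros that is `exp F / ∏_{U ≠ U₀} (w - z_U) ^ y_U` on the region `U₀`
and `(w - z_{U₀}) ^ y_{U₀}` outside of it, and this has no continuous logarithm. -/
theorem eq_zero_of_sum_mul_winding_eq_zero (hconn : Quiver.IsConnected V)
    (s : Finset D.BoundedRegion) (y : D.BoundedRegion → ℤ)
    (hy : ∀ r ∈ flowSpace V, (∀ a, r a ∈ realIntegers) →
      ∑ U ∈ s, y U * D.winding r U.1.somePoint = 0) : ∀ U ∈ s, y U = 0 := by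
  classical
  intro U₀ hU₀
  obtain ⟨F, hF⟩ := D.exists_log_prod_on_carrier hconn s y hy
  obtain ⟨F', hF'⟩ := ContinuousMap.exists_restrict_eq D.isCompact_carrier.isClosed
    ⟨D.carrier.domRestrict F, continuousOn_iff_continuous_domRestrict.1 hF.continuousOn⟩
  have hFF' : ∀ w ∈ D.carrier, F' w = F w := fun w hw => congrArg (fun f => f ⟨w, hw⟩) hF'
  set z₀ := U₀.1.somePoint with hz₀
  set P : ℂ → ℂ := fun w => ∏ U ∈ s.erase U₀, (w - U.1.somePoint) ^ y U with hP
  have hne : ∀ w ∈ closure U₀.1.1, ∀ U ∈ s.erase U₀, w - U.1.somePoint ≠ 0 := by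
    intro w hw U hU h
    have hmem : U.1.somePoint ∈ closure U₀.1.1 := by rwa [← sub_eq_zero.1 h]
    rw [closure_eq_self_union_frontier] at hmem
    rcases hmem with hmem | hmem
    · exact Finset.ne_of_mem_erase hU (BoundedRegion.eq_of_somePoint_mem hmem)
    · exact U.1.subset_compl U.1.somePoint_mem (U₀.1.frontier_subset hmem)
  have hP0 : ∀ w ∈ closure U₀.1.1, P w ≠ 0 := fun w hw =>
    Finset.prod_ne_zero_iff.2 fun U hU => zpow_ne_zero _ (hne w hw U hU)
  have hPc : ContinuousOn P (closure U₀.1.1) := continuousOn_finsetProd _ fun U hU =>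
    (continuousOn_id.sub continuousOn_const).zpow₀ _ fun w hw => Or.inl (hne w hw U hU)
  have hout : ∀ w ∈ closure (U₀.1.1)ᶜ, w - z₀ ≠ 0 := by
    intro w hw h
    rw [U₀.1.isOpen.isClosed_compl.closure_eq] at hw
    exact hw (by rw [sub_eq_zero.1 h]; exact U₀.1.somePoint_mem)
  set k : ℂ → ℂ := U₀.1.1.piecewise (fun w => Complex.exp (F' w) / P w)
    (fun w => (w - z₀) ^ y U₀) with hk
  have hkc : Continuous k := by
    refine continuous_piecewise (fun w hw => ?_) ?_ ?_
    · have hwc := U₀.1.frontier_subset hw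
      rw [hFF' w hwc, hF.exp_eq w hwc, div_eq_iff (hP0 w (frontier_subset_closure hw)), hP,
        ← Finset.mul_prod_erase s _ hU₀]
    · exact (Complex.continuous_exp.comp F'.continuous).continuousOn.div hPc hP0
    · exact (continuousOn_id.sub continuousOn_const).zpow₀ _ fun w hw => Or.inl (hout w hw)
  have hk0 : ∀ w, k w ≠ 0 := by
    intro w
    by_cases hw : w ∈ U₀.1.1
    · rw [hk, Set.piecewise_eq_of_mem _ _ _ hw]
      exact div_ne_zero (Complex.exp_ne_zero _) (hP0 w (subset_closure hw))
    · rw [hk, Set.piecewise_eq_of_notMem _ _ _ hw]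
      exact zpow_ne_zero _ (hout w (subset_closure hw))
  obtain ⟨κ, hκ⟩ := exists_isLogOn convex_univ hkc.continuousOn fun w _ => hk0 w
  obtain ⟨R, hR⟩ := U₀.2.subset_ball z₀
  have hR0 : 0 < R := by
    have := hR U₀.1.somePoint_mem
    rwa [Metric.mem_ball, dist_self] at this
  refine eq_zero_of_exp_eq_zpow (continuousOn_univ.1 hκ.continuousOn) (z₀ := z₀) hR0 fun w hw => ?_
  rw [hκ.exp_eq w (Set.mem_univ _), hk, Set.piecewise_eq_of_notMem]
  intro hwU
  have := hR hwU
  rw [Metric.mem_ball, dist_eq_norm, hw] at this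
  exact lt_irrefl _ this

end PlaneEmbedding

/-! ### Linear equivalences of lattices and polytopes -/

section Lattice

variable {E F : Type*} [AddCommGroup E] [Module ℝ E] [AddCommGroup F] [Module ℝ F]
  {Λ : AddSubgroup E} {Λ' : AddSubgroup F} {P : Set E}

theorem IsLatticePolytope.image (hP : IsLatticePolytope Λ P) (f : E →ₗ[ℝ] F)
    (hf : ∀ x ∈ Λ, f x ∈ Λ') : IsLatticePolytope Λ' (f '' P) := by
  classical
  obtain ⟨S, hS, rfl⟩ := hP
  refine ⟨S.image f, fun y hy => ?_, ?_⟩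
  · obtain ⟨x, hx, rfl⟩ := Finset.mem_image.1 hy
    exact hf x (hS x hx)
  · rw [f.image_convexHull, Finset.coe_image]

theorem IsLatticePolytope.integrallyEquivalent_image (hP : IsLatticePolytope Λ P) (e : E ≃ₗ[ℝ] F)
    (he : ∀ x, x ∈ Λ ↔ e x ∈ Λ') : IntegrallyEquivalent Λ P Λ' (e '' P) := by
  refine ⟨hP, hP.image e.toLinearMap fun x hx => (he x).1 hx, e.toLinearMap.toAffineMap,
    e.injective.injOn.bijOn_image, ?_⟩
  have h1 : ((Λ' : Set F) ∩ affineSpan ℝ (e '' P)) =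
      e '' ((Λ : Set E) ∩ affineSpan ℝ P) := by
    have h2 := AffineSubspace.map_span (f := e.toLinearMap.toAffineMap) P
    have h3 : (affineSpan ℝ (e '' P) : Set F) = e '' (affineSpan ℝ P) := by
      exact (congrArg (fun A : AffineSubspace ℝ F => (A : Set F)) h2).symm
    rw [h3, Set.image_inter e.injective]
    congr 1
    ext y
    constructor
    · intro hy
      exact ⟨e.symm y, (he _).2 (by simpa using hy), by simp⟩
    · rintro ⟨x, hx, rfl⟩
      exact (he x).1 hx
  rw [h1]
  exact e.injective.injOn.bijOn_image

theorem polarDual_image (e : E ≃ₗ[ℝ] F) (P : Set E) :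
    polarDual (e '' P) = e.symm.dualMap '' polarDual P := by
  ext y
  constructor
  · intro hy
    refine ⟨e.dualMap y, fun x hx => hy _ ⟨x, hx, rfl⟩, ?_⟩
    ext x
    simp
  · rintro ⟨z, hz, rfl⟩ _ ⟨x, hx, rfl⟩
    simpa using hz x hx

theorem dualMap_symm_mem_dualLattice (e : E ≃ₗ[ℝ] F) (he : ∀ x, x ∈ Λ ↔ e x ∈ Λ')
    {φ : Module.Dual ℝ E} (hφ : φ ∈ dualLattice Λ) : e.symm.dualMap φ ∈ dualLattice Λ' :=
  fun y hy => hφ _ ((he _).2 (by simpa using hy))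

end Lattice

theorem mem_integerLattice {ι : Type*} {x : ι → ℝ} :
    x ∈ integerLattice ι ↔ ∀ i, x i ∈ realIntegers := by
  simp [integerLattice, AddSubgroup.mem_pi]

theorem mem_flowLattice {V : Type*} [Quiver V] [Fintype (Quiver.Total V)] {r : flowSpace V} :
    r ∈ flowLattice V ↔ ∀ a, (r : Quiver.Total V → ℝ) a ∈ realIntegers :=
  mem_integerLattice

/-! ### Heights on the vertices of the dual quiver -/

/-- The height of a vertex: the coordinate at a normal vertex, and zero at a starred one. -/
def vertexHeight {N S : Type*} (x : N → ℝ) : N ⊕ S → ℝ :=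
  Sum.elim x 0

theorem sum_vertexVector_mul {N S : Type*} [Fintype N] (v : N ⊕ S) (x : N → ℝ) :
    ∑ i, vertexVector v i * x i = vertexHeight x v := by
  classical
  cases v <;> simp [vertexVector, vertexHeight, Pi.single_apply]

theorem vertexVector_mem_integerLattice {N S : Type*} (v : N ⊕ S) :
    vertexVector v ∈ integerLattice N := by
  classical
  rw [mem_integerLattice]
  intro i
  cases v with
  | inl j =>
    simp only [vertexVector, Pi.single_apply]
    split_ifs
    · exact ⟨1, by simp⟩
    · exact realIntegers.zero_mem
  | inr s => exact realIntegers.zero_mem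

theorem vertexHeight_mem_realIntegers {N S : Type*} {x : N → ℝ} (hx : x ∈ integerLattice N)
    (v : N ⊕ S) : vertexHeight x v ∈ realIntegers := by
  rcases v with v | v
  · exact mem_integerLattice.1 hx v
  · exact realIntegers.zero_mem

namespace PlaneEmbedding

variable {V : Type*} [Quiver V] (D : PlaneEmbedding V) [Finite V] [Fintype (Quiver.Total V)]

/-- The winding numbers of flows around the bounded regions. -/
noncomputable def windingMap : flowSpace V →ₗ[ℝ] (D.BoundedRegion → ℝ) where
  toFun r U := D.winding r U.1.somePoint
  map_add' r s := by ext U; exact D.winding_add r s _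
  map_smul' c r := by ext U; exact D.winding_smul c r _

theorem vertexHeight_windingMap (r : flowSpace V) (U : D.Region) :
    vertexHeight (D.windingMap r) (D.dualVertex U) = D.winding r U.somePoint := by
  by_cases h : Bornology.IsBounded U.1
  · rw [dualVertex, dif_pos h]
    rfl
  · simp [dualVertex, h, vertexHeight, U.winding_eq_zero h r.2]

theorem vertexHeight_left_sub_right (r : flowSpace V) {a : Quiver.Total V} {L R : D.Region}
    (hL : D.IsLeftRegion a L) (hR : D.IsRightRegion a R) :
    vertexHeight (D.windingMap r) (D.dualVertex L) -
      vertexHeight (D.windingMap r) (D.dualVertex R) = (r : Quiver.Total V → ℝ) a := by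
  rw [vertexHeight_windingMap, vertexHeight_windingMap, winding_left_sub_right r.2 hL hR]

theorem windingMap_injective : Function.Injective D.windingMap := by
  rw [injective_iff_map_eq_zero]
  intro r hr
  ext a
  obtain ⟨L, hL⟩ := D.exists_isLeftRegion a
  obtain ⟨R, hR⟩ := D.exists_isRightRegion a
  rw [← D.vertexHeight_left_sub_right r hL hR, hr]
  have h0 : ∀ v : D.BoundedRegion ⊕ Unit, vertexHeight (0 : D.BoundedRegion → ℝ) v = 0 := by
    rintro (v | v) <;> rfl
  simp [h0]

/-- The winding numbers around bounded regions are linearly independent functionals. A real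
relation is turned into an integral one by a `ℚ`-linear functional on `ℝ`. -/
theorem linearIndependent_winding (hconn : Quiver.IsConnected V) :
    LinearIndependent ℝ fun U : D.BoundedRegion => LinearMap.proj U ∘ₗ D.windingMap := by
  rw [linearIndependent_iff']
  intro s g hg U₀ hU₀
  rw [← Module.forall_dual_apply_eq_zero_iff ℚ]
  intro φ
  obtain ⟨b, hb⟩ := IsLocalization.exist_integer_multiples (nonZeroDivisors ℤ) s
    (fun U => φ (g U))
  have hb' : ∀ U, ∃ n : ℤ, U ∈ s → (n : ℚ) = (b : ℤ) * φ (g U) := by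
    intro U
    by_cases hU : U ∈ s
    · obtain ⟨n, hn⟩ := hb U hU
      exact ⟨n, fun _ => by simpa using hn⟩
    · exact ⟨0, fun h => absurd h hU⟩
  choose y hy using hb'
  have hy0 := D.eq_zero_of_sum_mul_winding_eq_zero hconn s y (fun r hr hint => by
    have hw : ∀ U : D.BoundedRegion, ∃ m : ℤ, (m : ℝ) = D.winding r U.1.somePoint := fun U =>
      D.winding_mem_realIntegers hr hint (U.1.subset_compl U.1.somePoint_mem)
    choose m hm using hw
    have h1 : ∑ U ∈ s, g U * D.winding r U.1.somePoint = 0 := by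
      have := LinearMap.congr_fun hg ⟨r, hr⟩
      simpa [windingMap] using this
    have h2 : ∑ U ∈ s, (m U : ℚ) * φ (g U) = 0 := by
      rw [← map_zero φ, ← h1, map_sum]
      refine Finset.sum_congr rfl fun U _ => ?_
      have h3 : g U * D.winding r U.1.somePoint = (m U : ℚ) • g U := by
        rw [← hm U, Rat.smul_def, mul_comm]
        norm_cast
      rw [h3, map_smul, smul_eq_mul]
    have h4 : ∑ U ∈ s, y U * m U = 0 := by
      have h5 : ∑ U ∈ s, (y U : ℚ) * m U = 0 := by
        rw [← mul_zero ((b : ℤ) : ℚ), ← h2, Finset.mul_sum]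
        refine Finset.sum_congr rfl fun U hU => ?_
        rw [hy U hU]
        ring
      exact_mod_cast h5
    simp only [← hm]
    exact_mod_cast h4) U₀ hU₀
  have h6 := hy U₀ hU₀
  rw [hy0, Int.cast_zero, eq_comm, mul_eq_zero] at h6
  exact h6.resolve_left (by exact_mod_cast nonZeroDivisors.coe_ne_zero b)

theorem finite_boundedRegion (hconn : Quiver.IsConnected V) : Finite D.BoundedRegion :=
  (D.linearIndependent_winding hconn).finite_of_isNoetherian

/-- Flows are determined by their winding numbers around the bounded regions, and these are
arbitrary: the independent functionals are at most as many as the dimension of the flow space. -/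
noncomputable def windingEquiv (hconn : Quiver.IsConnected V) [Fintype D.BoundedRegion] :
    flowSpace V ≃ₗ[ℝ] (D.BoundedRegion → ℝ) :=
  D.windingMap.linearEquivOfInjective D.windingMap_injective (by
    refine le_antisymm (LinearMap.finrank_le_finrank_of_injective D.windingMap_injective) ?_
    rw [Module.finrank_fintype_fun_eq_card, ← Subspace.dual_finrank_eq]
    exact (D.linearIndependent_winding hconn).fintype_card_le_finrank)

theorem mem_flowLattice_iff_windingMap_mem (r : flowSpace V) :
    r ∈ flowLattice V ↔ D.windingMap r ∈ integerLattice D.BoundedRegion := by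
  refine ⟨fun h => mem_integerLattice.2 fun U => D.winding_mem_realIntegers r.2
    (mem_flowLattice.1 h) (U.1.subset_compl U.1.somePoint_mem),
    fun h => mem_flowLattice.2 fun a => ?_⟩
  obtain ⟨L, hL⟩ := D.exists_isLeftRegion a
  obtain ⟨R, hR⟩ := D.exists_isRightRegion a
  rw [← D.vertexHeight_left_sub_right r hL hR]
  exact realIntegers.sub_mem (vertexHeight_mem_realIntegers h _)
    (vertexHeight_mem_realIntegers h _)

end PlaneEmbedding

/-! ### The flow polytope of an acyclic quiver -/

section FlowPolytope

variable {V : Type*} [Quiver V]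

/-- The number of vertices from which a vertex can be reached increases along the arrows. -/
theorem Quiver.IsAcyclic.exists_rank [Finite V] (h : Quiver.IsAcyclic V) :
    ∃ p : V → ℝ, ∀ a : Quiver.Total V, p a.left < p a.right := by
  refine ⟨fun v => ({w | Nonempty (Quiver.Path w v)} : Set V).ncard, fun a => ?_⟩
  refine Nat.cast_lt.2 (Set.ncard_lt_ncard ⟨?_, fun hsub => ?_⟩)
  · rintro w ⟨q⟩
    exact ⟨q.cons a.hom⟩
  · obtain ⟨q⟩ := hsub (show a.right ∈ {w | Nonempty (Quiver.Path w a.right)} from ⟨.nil⟩)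
    exact absurd (h _ (q.cons a.hom)) (by simp)

variable [Fintype (Quiver.Total V)]

theorem convex_flowPolytope : Convex ℝ (flowPolytope V) := by
  intro r hr s hs x y hx hy hxy a
  have h1 := hr a
  have h2 := hs a
  simp only [Submodule.coe_add, Submodule.coe_smul, Pi.add_apply, Pi.smul_apply, smul_eq_mul]
  nlinarith

theorem zero_mem_interior_flowPolytope : (0 : flowSpace V) ∈ interior (flowPolytope V) := by
  rw [mem_interior]
  refine ⟨{r | ∀ a, -1 < (r : Quiver.Total V → ℝ) a}, fun r hr a => (hr a).le, ?_,
    fun a => by simp⟩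
  rw [Set.ofPred_forall]
  exact isOpen_iInter_of_finite fun a =>
    isOpen_lt continuous_const ((continuous_apply a).comp continuous_subtype_val)

/-- If flows are differences of heights, integral ones of integral heights, then the extreme
points of the flow polytope are integral: the heights with a given nonzero fractional part can be
moved up and down together, because no inequality between them and the other heights is sharp. -/
theorem extremePoints_flowPolytope_subset {N S : Type*} [Finite N]
    (e : flowSpace V ≃ₗ[ℝ] (N → ℝ)) (src tgt : Quiver.Total V → N ⊕ S)
    (he : ∀ (r : flowSpace V) a, (r : Quiver.Total V → ℝ) a =
      vertexHeight (e r) (src a) - vertexHeight (e r) (tgt a))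
    (hint : ∀ r, r ∈ flowLattice V ↔ e r ∈ integerLattice N) :
    (flowPolytope V).extremePoints ℝ ⊆ flowLattice V := by
  classical
  intro r hr
  rw [mem_extremePoints] at hr
  obtain ⟨hrP, hext⟩ := hr
  rw [SetLike.mem_coe, hint, mem_integerLattice]
  by_contra! hne
  obtain ⟨i, hi⟩ := hne
  set α := Int.fract (e r i) with hα
  have hα0 : α ≠ 0 := by
    intro h
    refine hi ⟨⌊e r i⌋, ?_⟩
    have := Int.floor_add_fract (e r i)
    rw [← hα, h, add_zero] at this
    exact this
  set x : N → ℝ := fun j => if Int.fract (e r j) = α then 1 else 0 with hx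
  have hxv : ∀ v : N ⊕ S, vertexHeight x v =
      if Int.fract (vertexHeight (e r) v) = α then 1 else 0 := by
    rintro (v | v)
    · rfl
    · simp [vertexHeight, hα0.symm]
  set c := e.symm x with hc
  have hca : ∀ a, (c : Quiver.Total V → ℝ) a = vertexHeight x (src a) - vertexHeight x (tgt a) := by
    intro a
    rw [he c a, hc, e.apply_symm_apply]
  have htight : ∀ a, (r : Quiver.Total V → ℝ) a = -1 → (c : Quiver.Total V → ℝ) a = 0 := by
    intro a ha
    have h1 : vertexHeight (e r) (src a) = vertexHeight (e r) (tgt a) + (-1 : ℤ) := by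
      have := he r a
      push_cast
      linarith
    rw [hca, hxv, hxv, h1, Int.fract_add_intCast, sub_self]
  have hev : ∀ᶠ ε in nhds (0 : ℝ), ∀ a,
      -1 ≤ (r : Quiver.Total V → ℝ) a + ε * (c : Quiver.Total V → ℝ) a := by
    rw [Filter.eventually_all]
    intro a
    rcases (hrP a).eq_or_lt with h | h
    · rw [htight a h.symm, ← h]
      simp
    · have hcont : Continuous fun ε : ℝ =>
          (r : Quiver.Total V → ℝ) a + ε * (c : Quiver.Total V → ℝ) a := by fun_prop
      have := hcont.tendsto 0
      simp only [zero_mul, add_zero] at this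
      exact (this.eventually_const_lt h).mono fun _ h => h.le
  obtain ⟨δ, hδ, hball⟩ := Metric.eventually_nhds_iff_ball.1 hev
  have hmem : ∀ ε, |ε| < δ → r + ε • c ∈ flowPolytope V := fun ε hε a => by
    simpa using hball ε (by simpa using hε) a
  have hδ2 : |δ / 2| < δ := by rw [abs_of_pos (by linarith)]; linarith
  have h1 := (hext _ (hmem (δ / 2) hδ2) _ (hmem (-(δ / 2)) (by rwa [abs_neg]))
    ⟨1 / 2, 1 / 2, by norm_num, by norm_num, by norm_num, by module⟩).1
  have h2 : c = 0 := by
    have h3 : (δ / 2) • c = 0 := by simpa using h1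
    exact (smul_eq_zero.1 h3).resolve_left (by linarith)
  have h4 : x = 0 := by
    rw [← e.apply_symm_apply x, ← hc, h2, map_zero]
  have h5 : x i = 1 := by simp [hx, hα]
  rw [h4] at h5
  exact zero_ne_one h5

variable [Finite V]

/-- Weighted by the increments of a rank function, the values of a flow sum to zero, so that a
lower bound on all of them gives an upper bound. -/
theorem isCompact_flowPolytope (hacyc : Quiver.IsAcyclic V) : IsCompact (flowPolytope V) := by
  obtain ⟨p, hp⟩ := hacyc.exists_rank
  have hclosed : IsClosed (flowPolytope V) := by
    rw [flowPolytope, Set.ofPred_forall]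
    exact isClosed_iInter fun a =>
      isClosed_le continuous_const ((continuous_apply a).comp continuous_subtype_val)
  refine Metric.isCompact_of_isClosed_isBounded hclosed ?_
  set M : Quiver.Total V → ℝ := fun a => (∑ b : Quiver.Total V, (p b.right - p b.left)) / (p a.right - p a.left)
    with hM
  have hbound : ∀ r ∈ flowPolytope V, ∀ a, (r : Quiver.Total V → ℝ) a ≤ M a := by
    intro r hr a
    have hpa : 0 < p a.right - p a.left := sub_pos.2 (hp a)
    rw [hM, le_div_iff₀ hpa]
    have h1 : ∑ b, (r : Quiver.Total V → ℝ) b * (p b.right - p b.left) = 0 :=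
      sum_smul_sub_eq_zero r.2 p
    have h2 : ((r : Quiver.Total V → ℝ) a + 1) * (p a.right - p a.left) ≤
        ∑ b, ((r : Quiver.Total V → ℝ) b + 1) * (p b.right - p b.left) :=
      Finset.single_le_sum (f := fun b : Quiver.Total V =>
          ((r : Quiver.Total V → ℝ) b + 1) * (p b.right - p b.left))
        (fun b _ => mul_nonneg (by linarith [hr b]) (sub_pos.2 (hp b)).le) (Finset.mem_univ a)
    simp only [add_mul, one_mul, Finset.sum_add_distrib, h1, zero_add] at h2
    linarith
  have hb : Bornology.IsBounded (Set.Icc (fun _ : Quiver.Total V => (-1 : ℝ)) M) :=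
    Metric.isBounded_Icc _ _
  obtain ⟨C, hC⟩ := hb.exists_norm_le
  exact isBounded_iff_forall_norm_le.2
    ⟨C, fun r hr => hC r.1 ⟨fun a => hr a, fun a => hbound r hr a⟩⟩

theorem finite_flowPolytope_inter_flowLattice (hacyc : Quiver.IsAcyclic V) :
    (flowPolytope V ∩ flowLattice V).Finite := by
  obtain ⟨C, hC⟩ := (isCompact_flowPolytope hacyc).isBounded.exists_norm_le
  have hfin : (Set.univ.pi fun _ : Quiver.Total V =>
      ((↑) : ℤ → ℝ) '' Set.Icc (-⌈C⌉) ⌈C⌉).Finite :=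
    Set.Finite.pi fun _ => (Set.finite_Icc _ _).image _
  refine (hfin.preimage Subtype.val_injective.injOn).subset fun r hr => ?_
  rw [Set.mem_preimage, Set.mem_univ_pi]
  intro a
  obtain ⟨n, hn⟩ := mem_flowLattice.1 hr.2 a
  have h1 : |(n : ℝ)| ≤ C := by
    have h2 := norm_le_pi_norm (r : Quiver.Total V → ℝ) a
    rw [← hn, Real.norm_eq_abs] at h2
    exact h2.trans (hC r hr.1)
  have h3 := abs_le.1 (h1.trans (Int.le_ceil C))
  exact ⟨n, ⟨by exact_mod_cast h3.1, by exact_mod_cast h3.2⟩, hn⟩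

theorem isLatticePolytope_flowPolytope (hacyc : Quiver.IsAcyclic V)
    (hext : (flowPolytope V).extremePoints ℝ ⊆ flowLattice V) :
    IsLatticePolytope (flowLattice V) (flowPolytope V) := by
  have hfin := finite_flowPolytope_inter_flowLattice hacyc
  refine ⟨hfin.toFinset, fun x hx => (hfin.mem_toFinset.1 hx).2, ?_⟩
  rw [hfin.coe_toFinset]
  refine Set.Subset.antisymm ?_ (convexHull_min Set.inter_subset_left convex_flowPolytope)
  rw [← closure_convexHull_extremePoints (isCompact_flowPolytope hacyc) convex_flowPolytope]
  exact closure_minimal (convexHull_mono fun x hx =>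
    ⟨by rw [closure_convexHull_extremePoints (isCompact_flowPolytope hacyc) convex_flowPolytope]
        exact extremePoints_subset hx, hext hx⟩) (by
      rw [closure_convexHull_extremePoints (isCompact_flowPolytope hacyc) convex_flowPolytope]
      exact hfin.isClosed_convexHull ℝ)

end FlowPolytope

/-! ### The polar dual of the flow polytope -/

/-- A linear equivalence `e` from the flow space to `ℝ^N` identifies `ℝ^N` with the dual of the
flow space: `x` acts on a flow `r` as `-∑ x_i e(r)_i`. The sign makes the difference
`vertexVector (tgt a) - vertexVector (src a)` act as the coordinate at the arrow `a`. -/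
noncomputable def heightDualEquiv {V N : Type*} [Quiver V] [Fintype (Quiver.Total V)] [Fintype N]
    [DecidableEq N] (e : flowSpace V ≃ₗ[ℝ] (N → ℝ)) : (N → ℝ) ≃ₗ[ℝ] Module.Dual ℝ (flowSpace V) :=
  (LinearEquiv.neg ℝ).trans ((Pi.basisFun ℝ N).toDualEquiv.trans e.dualMap)

theorem heightDualEquiv_apply {V N : Type*} [Quiver V] [Fintype (Quiver.Total V)] [Fintype N]
    [DecidableEq N] (e : flowSpace V ≃ₗ[ℝ] (N → ℝ)) (x : N → ℝ) (r : flowSpace V) :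
    heightDualEquiv e x r = -∑ i, x i * e r i := by
  rw [heightDualEquiv]
  simp only [LinearEquiv.trans_apply, LinearEquiv.neg_apply, LinearEquiv.dualMap_apply, map_neg,
    LinearMap.neg_apply, Module.Basis.toDualEquiv_apply]
  congr 1
  conv_lhs => rw [← (Pi.basisFun ℝ N).sum_repr x, map_sum, LinearMap.sum_apply]
  refine Finset.sum_congr rfl fun i _ => ?_
  rw [map_smul, LinearMap.smul_apply, (Pi.basisFun ℝ N).toDual_apply_right]
  simp

section Polar

variable {V N S : Type*} [Quiver V] [Fintype (Quiver.Total V)] [Fintype N] [DecidableEq N]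
  (e : flowSpace V ≃ₗ[ℝ] (N → ℝ))

theorem heightDualEquiv_sub {src tgt : Quiver.Total V → N ⊕ S}
    (he : ∀ (r : flowSpace V) a, (r : Quiver.Total V → ℝ) a =
      vertexHeight (e r) (src a) - vertexHeight (e r) (tgt a)) (a : Quiver.Total V)
    (r : flowSpace V) :
    heightDualEquiv e (vertexVector (tgt a) - vertexVector (src a)) r =
      (r : Quiver.Total V → ℝ) a := by
  rw [heightDualEquiv_apply, he r a]
  simp only [Pi.sub_apply, sub_mul, Finset.sum_sub_distrib, sum_vertexVector_mul]
  ring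

theorem mem_integerLattice_iff_heightDualEquiv
    (hint : ∀ r, r ∈ flowLattice V ↔ e r ∈ integerLattice N) (x : N → ℝ) :
    x ∈ integerLattice N ↔ heightDualEquiv e x ∈ dualLattice (flowLattice V) := by
  constructor
  · intro hx r hr
    rw [heightDualEquiv_apply]
    refine realIntegers.neg_mem (AddSubgroup.sum_mem _ fun i _ => ?_)
    obtain ⟨n, hn⟩ := mem_integerLattice.1 hx i
    obtain ⟨m, hm⟩ := mem_integerLattice.1 ((hint r).1 hr) i
    exact ⟨n * m, by rw [← hn, ← hm]; simp⟩
  · intro h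
    rw [mem_integerLattice]
    intro i
    have h1 := h (e.symm (Pi.single i 1)) (by
      rw [hint, e.apply_symm_apply, mem_integerLattice]
      intro j
      rw [Pi.single_apply]
      split_ifs
      · exact ⟨1, by simp⟩
      · exact realIntegers.zero_mem)
    rw [heightDualEquiv_apply, e.apply_symm_apply] at h1
    simpa [Pi.single_apply] using realIntegers.neg_mem h1

/-- The polar dual of the flow polytope is spanned by zero and the coordinate functionals. -/
theorem polarDual_flowPolytope {R : Set (N → ℝ)} (hR : R.Finite)
    (hR1 : ∀ u ∈ R, ∃ a, ∀ r, heightDualEquiv e u r = (r : Quiver.Total V → ℝ) a)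
    (hR2 : ∀ a, ∃ u ∈ insert 0 R, ∀ r, heightDualEquiv e u r = (r : Quiver.Total V → ℝ) a) :
    polarDual (flowPolytope V) = heightDualEquiv e '' convexHull ℝ (insert 0 R) := by
  apply Set.Subset.antisymm
  · intro y hy
    obtain ⟨x, rfl⟩ := (heightDualEquiv e).surjective y
    refine ⟨x, ?_, rfl⟩
    by_contra hx
    obtain ⟨f, u, hfx, hf⟩ := geometric_hahn_banach_point_closed (convex_convexHull ℝ _)
      ((hR.insert 0).isClosed_convexHull ℝ) hx
    have hu : u < 0 := by
      have := hf 0 (subset_convexHull ℝ _ (Set.mem_insert 0 R))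
      rwa [map_zero] at this
    set r : flowSpace V := e.symm fun i => -f (Pi.single i 1) with hr
    have hfr : ∀ z, heightDualEquiv e z r = f z := by
      intro z
      rw [heightDualEquiv_apply, hr, e.apply_symm_apply]
      conv_rhs => rw [pi_eq_sum_univ' z, map_sum]
      rw [← Finset.sum_neg_distrib]
      refine Finset.sum_congr rfl fun i _ => ?_
      rw [map_smul, smul_eq_mul]
      rw [mul_neg, neg_neg]
    have hmem : (-u)⁻¹ • r ∈ flowPolytope V := by
      intro a
      obtain ⟨w, hw, hwa⟩ := hR2 a
      have h1 := hf w (subset_convexHull ℝ _ hw)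
      rw [← hwa, map_smul, hfr, smul_eq_mul, ← div_eq_inv_mul, le_div_iff₀ (by linarith)]
      linarith
    have h2 := hy _ hmem
    rw [map_smul, hfr, smul_eq_mul, ← div_eq_inv_mul, le_div_iff₀ (by linarith)] at h2
    linarith
  · rintro _ ⟨x, hx, rfl⟩
    have hconv : Convex ℝ {x | heightDualEquiv e x ∈ polarDual (flowPolytope V)} := by
      intro x hx y hy s t hs ht hst r hr
      have h1 := hx r hr
      have h2 := hy r hr
      simp only [map_add, map_smul, LinearMap.add_apply, LinearMap.smul_apply, smul_eq_mul]
      nlinarith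
    refine convexHull_min (fun u hu => ?_) hconv hx
    rcases hu with rfl | hu
    · intro r _
      simp
    · obtain ⟨a, ha⟩ := hR1 u hu
      intro r hr
      rw [ha]
      exact hr a

/-- A positive combination of the coordinate functionals vanishes on all flows. -/
theorem zero_mem_convexHull_of_isAcyclic [Finite V] (hacyc : Quiver.IsAcyclic V) [Nonempty N]
    {R : Set (N → ℝ)}
    (hR2 : ∀ a, ∃ u ∈ insert 0 R, ∀ r, heightDualEquiv e u r = (r : Quiver.Total V → ℝ) a) :
    0 ∈ convexHull ℝ R := by
  classical
  obtain ⟨p, hp⟩ := hacyc.exists_rank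
  choose u hu hur using hR2
  have hsum : ∑ a, (p a.right - p a.left) • u a = 0 := by
    apply (heightDualEquiv e).injective
    ext r
    rw [map_zero, map_sum, LinearMap.sum_apply, LinearMap.zero_apply,
      ← sum_smul_sub_eq_zero r.2 p]
    refine Finset.sum_congr rfl fun a _ => ?_
    rw [map_smul, LinearMap.smul_apply, hur, smul_eq_mul, smul_eq_mul, mul_comm]
  have hne : ∃ a, u a ≠ 0 := by
    by_contra! h
    obtain ⟨i⟩ := ‹Nonempty N›
    have h1 : e.symm (Pi.single i 1) = 0 := by
      ext a
      rw [← hur, h a, map_zero, LinearMap.zero_apply]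
      rfl
    rw [LinearEquiv.map_eq_zero_iff] at h1
    simpa using congrFun h1 i
  have hsum' : ∑ a with u a ≠ 0, (p a.right - p a.left) • u a = 0 := by
    refine Eq.trans ?_ hsum
    refine Finset.sum_filter_of_ne fun a _ h h' => h ?_
    rw [h', smul_zero]
  have hpos : 0 < ∑ a with u a ≠ 0, (p a.right - p a.left) := by
    obtain ⟨a, ha⟩ := hne
    exact Finset.sum_pos (fun a _ => sub_pos.2 (hp a)) ⟨a, by simpa using ha⟩
  have := Finset.centerMass_mem_convexHull (R := ℝ) (s := R)
    (Finset.univ.filter fun a => u a ≠ 0) (w := fun a => p a.right - p a.left) (z := u)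
    (fun a _ => (sub_pos.2 (hp a)).le) hpos
    (fun a ha => (hu a).resolve_left (Finset.mem_filter.1 ha).2)
  rwa [Finset.centerMass, hsum', smul_zero] at this

end Polar

/-! ### Root polytopes and reflexivity -/

theorem theoremB {V : Type*} [Quiver V] [Finite V] [Fintype (Quiver.Total V)]
    (hconn : Quiver.IsConnected V) (hacyc : Quiver.IsAcyclic V) (D : PlaneEmbedding V) :
    Finite D.BoundedRegion ∧
    HasOriginInterior (flowLattice V) (flowPolytope V) ∧
    (Nonempty D.BoundedRegion →
      IntegrallyEquivalent (integerLattice D.BoundedRegion) D.dual.rootPolytope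
        (dualLattice (flowLattice V)) (polarDual (flowPolytope V))) ∧
    IsReflexivePolytope (flowLattice V) (flowPolytope V) := by
  classical
  have hfin := D.finite_boundedRegion hconn
  have := Fintype.ofFinite D.BoundedRegion
  set e := D.windingEquiv hconn
  have hint : ∀ r, r ∈ flowLattice V ↔ e r ∈ integerLattice D.BoundedRegion :=
    D.mem_flowLattice_iff_windingMap_mem
  choose L hL using D.exists_isLeftRegion
  choose R hR using D.exists_isRightRegion
  have he : ∀ (r : flowSpace V) a, (r : Quiver.Total V → ℝ) a =
      vertexHeight (e r) (D.dualVertex (L a)) - vertexHeight (e r) (D.dualVertex (R a)) :=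
    fun r a => (D.vertexHeight_left_sub_right r (hL a) (hR a)).symm
  have hlat : IsLatticePolytope (flowLattice V) (flowPolytope V) :=
    isLatticePolytope_flowPolytope hacyc (extremePoints_flowPolytope_subset e _ _ he hint)
  set roots : Set (D.BoundedRegion → ℝ) :=
    {u | ∃ x y, D.dual.Arr x y ∧ u = vertexVector y - vertexVector x} with hroots
  have hrfin : roots.Finite :=
    (Set.finite_range fun q : (D.BoundedRegion ⊕ Unit) × (D.BoundedRegion ⊕ Unit) =>
      (vertexVector q.2 - vertexVector q.1 : D.BoundedRegion → ℝ)).subset (by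
      rintro u ⟨x, y, -, rfl⟩
      exact ⟨(x, y), rfl⟩)
  have hrint : ∀ u ∈ insert 0 roots, u ∈ integerLattice D.BoundedRegion := by
    rintro u (rfl | ⟨x, y, -, rfl⟩)
    · exact AddSubgroup.zero_mem _
    · exact AddSubgroup.sub_mem _ (vertexVector_mem_integerLattice y)
        (vertexVector_mem_integerLattice x)
  have hr1 : ∀ u ∈ roots, ∃ a, ∀ r, heightDualEquiv e u r = (r : Quiver.Total V → ℝ) a := by
    rintro u ⟨x, y, ⟨-, a, L', R', hL', hR', rfl, rfl⟩, rfl⟩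
    refine ⟨a, fun r => ?_⟩
    rw [heightDualEquiv_apply, ← D.vertexHeight_left_sub_right r hL' hR']
    simp only [Pi.sub_apply, sub_mul, Finset.sum_sub_distrib, sum_vertexVector_mul]
    rw [neg_sub]
    rfl
  have hr2 : ∀ a, ∃ u ∈ insert 0 roots, ∀ r,
      heightDualEquiv e u r = (r : Quiver.Total V → ℝ) a := by
    intro a
    refine ⟨_, ?_, heightDualEquiv_sub e he a⟩
    by_cases h : D.dualVertex (L a) = D.dualVertex (R a)
    · rw [h, sub_self]
      exact Set.mem_insert _ _
    · exact Or.inr ⟨_, _, ⟨h, a, L a, R a, hL a, hR a, rfl, rfl⟩, rfl⟩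
  have hpolar := polarDual_flowPolytope e hrfin hr1 hr2
  have hΦ := mem_integerLattice_iff_heightDualEquiv e hint
  have hullLattice : ∀ T : Set (D.BoundedRegion → ℝ), T ⊆ insert 0 roots →
      IsLatticePolytope (integerLattice D.BoundedRegion) (convexHull ℝ T) := by
    intro T hT
    have hTf : T.Finite := (hrfin.insert 0).subset hT
    exact ⟨hTf.toFinset, fun x hx => hrint x (hT (hTf.mem_toFinset.1 hx)), by
      rw [hTf.coe_toFinset]⟩
  refine ⟨hfin, ⟨hlat, zero_mem_interior_flowPolytope⟩, fun hne => ?_, ?_⟩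
  · have h0 := zero_mem_convexHull_of_isAcyclic e hacyc hr2
    have hhull : convexHull ℝ (insert 0 roots) = D.dual.rootPolytope := by
      refine Set.Subset.antisymm (convexHull_min ?_ (convex_convexHull ℝ _))
        (convexHull_mono (Set.subset_insert _ _))
      exact Set.insert_subset h0 (subset_convexHull ℝ _)
    rw [hpolar, hhull]
    exact (hullLattice roots (Set.subset_insert _ _)).integrallyEquivalent_image _ hΦ
  · set K : flowSpace V ≃ₗ[ℝ] (Fin (Fintype.card D.BoundedRegion) → ℝ) :=
      e.trans (LinearEquiv.funCongrLeft ℝ ℝ (Fintype.equivFin D.BoundedRegion).symm) with hK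
    have hKint : ∀ r, r ∈ flowLattice V ↔ K r ∈ integerLattice (Fin _) := by
      intro r
      rw [hint, mem_integerLattice, mem_integerLattice]
      exact ((Fintype.equivFin D.BoundedRegion).symm.forall_congr_right
        (q := fun U => e r U ∈ realIntegers)).symm
    refine ⟨_, K '' flowPolytope V, ⟨⟨hlat.image K.toLinearMap fun r hr => (hKint r).1 hr, ?_⟩, ?_⟩,
      hlat.integrallyEquivalent_image K hKint⟩
    · have := K.toContinuousLinearEquiv.toHomeomorph.image_interior (flowPolytope V)
      refine this ▸ ⟨0, zero_mem_interior_flowPolytope, map_zero K⟩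
    · rw [polarDual_image]
      refine IsLatticePolytope.image (Λ := dualLattice (flowLattice V)) ?_
        K.symm.dualMap.toLinearMap fun φ hφ => dualMap_symm_mem_dualLattice K hKint hφ
      rw [hpolar]
      exact (hullLattice _ subset_rfl).image (heightDualEquiv e).toLinearMap
        fun x hx => (hΦ x).1 hx
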